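/- All manifolds are finite-dimensional, either real smooth or complex (then "smooth" means holomorphic and "diffeomorphism" means biholomorphism), and submanifolds are embedded. Let $\Gamma\rightrightarrows M$ be a Lie groupoid with source $s$ and target $t$, where $\gamma\gamma'$ is defined when $t(\gamma)=s(\gamma')$. For $I,J\subset M$ write $\Gamma_I=s^{-1}(I)$ and $\Gamma_I^J=s^{-1}(I)\cap t^{-1}(J)$. Let $\mathcal S\subset M$ be a $\Gamma$-stable submanifold: $t(\gamma)\in\mathcal S\Leftrightarrow s(\gamma)\in\mathcal S$ for all $\gamma\in\Gamma$. A *$\Gamma$-resolution* of $\overline{\mathcal S}$ is a (Hausdorff) manifold $Z$ with a smooth map $\phi:Z\to M$ such that $\phi^{-1}(\mathcal S)$ is dense in $Z$, $\phi$ restricts to a diffeomorphism $\phi^{-1}(\mathcal S)\to\mathcal S$, and $(Z,\phi)$ carries a smooth right $\Gamma$-action $(z,\gamma)\mapsto z\cdot\gamma$, defined for $\phi(z)=s(\gamma)$, with $\phi(z\cdot\gamma)=t(\gamma)$. Let $L\subset M$ be a submanifold with $L\cap\mathcal S$ dense in $L$. The $\Gamma$-resolution $(Z,\phi)$ is *$L$-compatible*,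 with transversal submanifold $\tilde L$, if $\tilde L\subset Z$ is a submanifold such that $\phi$ restricts to a diffeomorphism $\tilde L\to L$, such that $T_z\tilde L+T_z(z\cdot\Gamma)=T_zZ$ for all $z\in\tilde L$, and such that $\tilde L$ meets all the $\Gamma$-orbits contained in $\phi^{-1}(\mathcal S)$. A Lie subgroupoid $R\rightrightarrows L$ of $\Gamma\rightrightarrows M$ is *closed* if $R$ is closed in $\Gamma_L^L$. It is *full in $\mathcal S$* if $L\cap\mathcal S$ is dense in $L$; $T_m\mathcal S=T_mF_m+T_mL$ for all $m\in L\cap\mathcal S$, where $F_m$ is the $\Gamma$-orbit of $m$; $L$ meets every $\Gamma$-orbit contained in $\mathcal S$; and $R_{L\cap\mathcal S}^{L\cap\mathcal S}=\Gamma_{L\cap\mathcal S}^{L\cap\mathcal S}$. In that case $Z(R)=R\backslash\Gamma_L$ denotes the quotient of $\Gamma_L$ by $\gamma\sim r\gamma$ ($r\in R$, $t(r)=s(\gamma)$), with the quotient topology, with the map $\phi_R:[\gamma]\mapsto t(\gamma)$ to $M$ and the right action $[\gamma]\cdot\gamma'=[\gamma\gamma']$. **Proposition.** Let $(Z,\phi)$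 be an $L$-compatible $\Gamma$-resolution of $\overline{\mathcal S}$ with transversal submanifold $\tilde L$, and let $\psi:L\to\tilde L$ be the inverse of $\phi_{|\tilde L}$. Then: 1. The set $R\subset\Gamma_L$ of all arrows $r\in\Gamma_L$ with $\psi(s(r))\cdot r\in\tilde L$ is a closed Lie subgroupoid $R\rightrightarrows L$ of $\Gamma\rightrightarrows M$, full in $\mathcal S$. 2. The $\Gamma$-orbit $\tilde L\cdot\Gamma$ of $\tilde L$ is an open subset of $Z$, and it coincides, as a $\Gamma$-resolution, with $(Z(R),\phi_R)$. That is, $Z(R)$ has a manifold structure for which $\Gamma_L\to Z(R)$ is a smooth submersion and $(Z(R),\phi_R)$ is a $\Gamma$-resolution of $\overline{\mathcal S}$, and $[\gamma]\mapsto\psi(s(\gamma))\cdot\gamma$ is a well-defined $\Gamma$-equivariant diffeomorphism, commuting with the maps to $M$, from $Z(R)$ onto the open subset $\tilde L\cdot\Gamma$ of $Z$. 3. If moreover $\tilde L$ meets all the $\Gamma$-orbits of $Z$, then $(Z,\phi)$ and $(Z(R),\phi_R)$ coincide: the map of part 2 is an isomorphism of $\Gamma$-resolutions from $Z(R)$ onto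 $Z$. -/

import Mathlib

open scoped Manifold ContDiff Topology Pointwise

/-! All manifolds are finite dimensional, without boundary, over `𝕜 = ℝ` (smooth case) or `𝕜 = ℂ`
(holomorphic case: over `ℂ`, being `C^∞` in the sense of complex derivatives is being
holomorphic). -/

section Submanifolds

variable {𝕜 : Type*} [RCLike 𝕜]

/-- A map `f : A → Y` on a subset `A` of a manifold `X` is smooth (holomorphic) if near every point
of `A` it extends to a smooth (holomorphic) map on `X`. For an embedded submanifold `A` this is
smoothness for the induced manifold structure of `A`. -/
def SmoothOnSubset {E H E' H' X Y : Type*}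
    [NormedAddCommGroup E] [NormedSpace 𝕜 E] [TopologicalSpace H] (I : ModelWithCorners 𝕜 E H)
    [NormedAddCommGroup E'] [NormedSpace 𝕜 E'] [TopologicalSpace H'] (J : ModelWithCorners 𝕜 E' H')
    [TopologicalSpace X] [ChartedSpace H X] [TopologicalSpace Y] [ChartedSpace H' Y]
    (A : Set X) (f : A → Y) : Prop :=
  ∀ x : A, ∃ g : X → Y, ContMDiffAt I J ∞ g (x : X) ∧ ∀ᶠ y : A in 𝓝 x, g (y : X) = f y

variable {E X E' Y : Type*} [NormedAddCommGroup E] [NormedSpace 𝕜 E]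
  [TopologicalSpace X] [ChartedSpace E X]
  [NormedAddCommGroup E'] [NormedSpace 𝕜 E'] [TopologicalSpace Y] [ChartedSpace E' Y]

/-- Embedded submanifolds, through slice charts: around each of its points, `A` is given in some
chart of `X` by a fixed linear subspace `F` of the model space. -/
def IsEmbeddedSubmanifold (𝕜 : Type*) [RCLike 𝕜] {E X : Type*} [NormedAddCommGroup E]
    [NormedSpace 𝕜 E] [TopologicalSpace X] [ChartedSpace E X] (A : Set X) : Prop :=
  ∃ F : Submodule 𝕜 E, ∀ x ∈ A, ∃ e ∈ IsManifold.maximalAtlas 𝓘(𝕜, E) ∞ X,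
    x ∈ e.source ∧ ∀ y ∈ e.source, (y ∈ A ↔ e y ∈ F)

/-- `f` restricts to a diffeomorphism (biholomorphism) from the subset `A` to the subset `B`. -/
def IsDiffeoBetween (𝕜 : Type*) [RCLike 𝕜] {E X E' Y : Type*} [NormedAddCommGroup E]
    [NormedSpace 𝕜 E] [TopologicalSpace X] [ChartedSpace E X]
    [NormedAddCommGroup E'] [NormedSpace 𝕜 E'] [TopologicalSpace Y] [ChartedSpace E' Y]
    (f : X → Y) (A : Set X) (B : Set Y) : Prop :=
  Set.BijOn f A B ∧
  SmoothOnSubset 𝓘(𝕜, E) 𝓘(𝕜, E') A (fun x => f x) ∧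
  ∃ g : B → X, (∀ b : B, g b ∈ A ∧ f (g b) = b) ∧ SmoothOnSubset 𝓘(𝕜, E') 𝓘(𝕜, E) B g

/-- The curve `c`, defined near `0 ∈ 𝕜`, is smooth at `0`. -/
def SmoothCurve (𝕜 : Type*) [RCLike 𝕜] {E X : Type*} [NormedAddCommGroup E]
    [NormedSpace 𝕜 E] [TopologicalSpace X] [ChartedSpace E X] (c : 𝕜 → X) : Prop :=
  ContMDiffAt 𝓘(𝕜, 𝕜) 𝓘(𝕜, E) ∞ c 0

/-- The curve `c` passes through `x` at time `0` with velocity `v`. -/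
def HasVelocity (c : 𝕜 → X) (x : X) (v : TangentSpace 𝓘(𝕜, E) x) : Prop :=
  tangentMap 𝓘(𝕜, 𝕜) 𝓘(𝕜, E) c ⟨0, (1 : 𝕜)⟩ = (⟨x, v⟩ : TangentBundle 𝓘(𝕜, E) X)

/-- The tangent space `T_x A` of a submanifold `A` of `X`, as a subset of `T_x X`: the velocities
of the smooth curves in `A` through `x`. -/
def tangentVectors (𝕜 : Type*) [RCLike 𝕜] {E X : Type*} [NormedAddCommGroup E]
    [NormedSpace 𝕜 E] [TopologicalSpace X] [ChartedSpace E X] (A : Set X) (x : X) :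
    Set (TangentSpace 𝓘(𝕜, E) x) :=
  {v | ∃ c : 𝕜 → X, SmoothCurve (E := E) 𝕜 c ∧ (∀ᶠ ε in 𝓝 (0 : 𝕜), c ε ∈ A) ∧ HasVelocity c x v}

/-- For submanifolds `A ⊆ X` and `B ⊆ Y`, a smooth map `f : A → Y` with values in `B` is a
submersion `A → B`: its differential `T_x A → T_{f x} B` is onto for every `x ∈ A`. -/
def IsSubmersionBetween (𝕜 : Type*) [RCLike 𝕜] {E X E' Y : Type*} [NormedAddCommGroup E]
    [NormedSpace 𝕜 E] [TopologicalSpace X] [ChartedSpace E X]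
    [NormedAddCommGroup E'] [NormedSpace 𝕜 E'] [TopologicalSpace Y] [ChartedSpace E' Y]
    (A : Set X) (f : A → Y) (B : Set Y) : Prop :=
  ∀ x : A, ∀ v ∈ tangentVectors (E := E') 𝕜 B (f x),
    ∃ c : 𝕜 → A, c 0 = x ∧ SmoothCurve (E := E) 𝕜 (fun ε => (c ε : X)) ∧
      HasVelocity (fun ε => f (c ε)) (f x) v

end Submanifolds

/-- A Lie groupoid `Γ ⇉ M`. The product `mul γ γ'` is meaningful when `tgt γ = src γ'`; its values
on other pairs are irrelevant. -/
structure LieGroupoid (𝕜 : Type*) [RCLike 𝕜] {EΓ EM : Type*} (Γ M : Type*)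
    [NormedAddCommGroup EΓ] [NormedSpace 𝕜 EΓ] [NormedAddCommGroup EM] [NormedSpace 𝕜 EM]
    [TopologicalSpace Γ] [ChartedSpace EΓ Γ] [TopologicalSpace M] [ChartedSpace EM M] where
  src : Γ → M
  tgt : Γ → M
  unit : M → Γ
  inv : Γ → Γ
  mul : Γ → Γ → Γ
  src_unit : ∀ m, src (unit m) = m
  tgt_unit : ∀ m, tgt (unit m) = m
  src_inv : ∀ γ, src (inv γ) = tgt γ
  tgt_inv : ∀ γ, tgt (inv γ) = src γ
  src_mul : ∀ γ γ', tgt γ = src γ' → src (mul γ γ') = src γ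
  tgt_mul : ∀ γ γ', tgt γ = src γ' → tgt (mul γ γ') = tgt γ'
  mul_assoc : ∀ γ γ' γ'', tgt γ = src γ' → tgt γ' = src γ'' →
    mul (mul γ γ') γ'' = mul γ (mul γ' γ'')
  unit_mul : ∀ γ, mul (unit (src γ)) γ = γ
  mul_unit : ∀ γ, mul γ (unit (tgt γ)) = γ
  mul_inv : ∀ γ, mul γ (inv γ) = unit (src γ)
  inv_mul : ∀ γ, mul (inv γ) γ = unit (tgt γ)
  smooth_src : ContMDiff 𝓘(𝕜, EΓ) 𝓘(𝕜, EM) ∞ src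
  smooth_tgt : ContMDiff 𝓘(𝕜, EΓ) 𝓘(𝕜, EM) ∞ tgt
  submersion_src : Manifold.IsSubmersion 𝓘(𝕜, EΓ) 𝓘(𝕜, EM) ∞ src
  submersion_tgt : Manifold.IsSubmersion 𝓘(𝕜, EΓ) 𝓘(𝕜, EM) ∞ tgt
  smooth_unit : ContMDiff 𝓘(𝕜, EM) 𝓘(𝕜, EΓ) ∞ unit
  smooth_inv : ContMDiff 𝓘(𝕜, EΓ) 𝓘(𝕜, EΓ) ∞ inv
  smooth_mul : SmoothOnSubset (𝓘(𝕜, EΓ).prod 𝓘(𝕜, EΓ)) 𝓘(𝕜, EΓ)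
    {p : Γ × Γ | tgt p.1 = src p.2} (fun p => mul p.1.1 p.1.2)

namespace LieGroupoid

variable {𝕜 : Type*} [RCLike 𝕜] {EΓ EM EZ Γ M Z : Type*}
  [NormedAddCommGroup EΓ] [NormedSpace 𝕜 EΓ] [NormedAddCommGroup EM] [NormedSpace 𝕜 EM]
  [NormedAddCommGroup EZ] [NormedSpace 𝕜 EZ]
  [TopologicalSpace Γ] [ChartedSpace EΓ Γ] [TopologicalSpace M] [ChartedSpace EM M]
  [TopologicalSpace Z] [ChartedSpace EZ Z]
  (G : LieGroupoid 𝕜 (EΓ := EΓ) (EM := EM) Γ M)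

/-- `S ⊆ M` is `Γ`-stable. -/
def IsStable (S : Set M) : Prop := ∀ γ, G.tgt γ ∈ S ↔ G.src γ ∈ S

/-- `Γ_L`, the arrows with source in `L`. -/
def srcIn (L : Set M) : Set Γ := {γ | G.src γ ∈ L}

/-- `Γ_L^L'`, the arrows with source in `L` and target in `L'`. -/
def between (L L' : Set M) : Set Γ := {γ | G.src γ ∈ L ∧ G.tgt γ ∈ L'}

/-- `act` is a (smooth) right action of `Γ ⇉ M` on `φ : Z → M`. The point `act z γ = z · γ` is
meaningful when `φ z = src γ`; other values of `act` are irrelevant. -/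
structure IsRightModule (φ : Z → M) (act : Z → Γ → Z) : Prop where
  smooth : ContMDiff 𝓘(𝕜, EZ) 𝓘(𝕜, EM) ∞ φ
  map_act : ∀ z γ, φ z = G.src γ → φ (act z γ) = G.tgt γ
  act_unit : ∀ z, act z (G.unit (φ z)) = z
  act_mul : ∀ z γ γ', φ z = G.src γ → G.tgt γ = G.src γ' →
    act z (G.mul γ γ') = act (act z γ) γ'
  smooth_act : SmoothOnSubset (𝓘(𝕜, EZ).prod 𝓘(𝕜, EΓ)) 𝓘(𝕜, EZ)
    {p : Z × Γ | φ p.1 = G.src p.2} (fun p => act p.1.1 p.1.2)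

end LieGroupoid

/-- `φ : Z → M` is a resolution of the closure of the submanifold `S` of `M`. -/
structure IsResolution (𝕜 : Type*) [RCLike 𝕜] {EM EZ M Z : Type*}
    [NormedAddCommGroup EM] [NormedSpace 𝕜 EM] [NormedAddCommGroup EZ] [NormedSpace 𝕜 EZ]
    [TopologicalSpace M] [ChartedSpace EM M] [TopologicalSpace Z] [ChartedSpace EZ Z]
    (S : Set M) (φ : Z → M) : Prop where
  smooth : ContMDiff 𝓘(𝕜, EZ) 𝓘(𝕜, EM) ∞ φ
  dense : Dense (φ ⁻¹' S)
  diffeo : IsDiffeoBetween (E := EZ) (E' := EM) 𝕜 φ (φ ⁻¹' S) S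

namespace LieGroupoid

variable {𝕜 : Type*} [RCLike 𝕜] {EΓ EM EZ Γ M Z : Type*}
  [NormedAddCommGroup EΓ] [NormedSpace 𝕜 EΓ] [NormedAddCommGroup EM] [NormedSpace 𝕜 EM]
  [NormedAddCommGroup EZ] [NormedSpace 𝕜 EZ]
  [TopologicalSpace Γ] [ChartedSpace EΓ Γ] [TopologicalSpace M] [ChartedSpace EM M]
  [TopologicalSpace Z] [ChartedSpace EZ Z]
  (G : LieGroupoid 𝕜 (EΓ := EΓ) (EM := EM) Γ M)

/-- `(Z, φ)` with the action `act` is a `Γ`-resolution of the closure of `S`. -/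
def IsEquivariantResolution (S : Set M) (φ : Z → M) (act : Z → Γ → Z) : Prop :=
  G.IsRightModule (EZ := EZ) φ act ∧ IsResolution (EM := EM) (EZ := EZ) 𝕜 S φ

/-- The tangent space at `z` of the `Γ`-orbit of `z` in the right module `(Z, φ)`: the velocities
at `0` of the curves `ε ↦ z · γ(ε)`, for `γ` a smooth curve in the source fibre over `φ z` with
`γ(0)` the unit at `φ z`. This is the image of the infinitesimal action of the Lie algebroid. -/
def orbitTangentVectors (φ : Z → M) (act : Z → Γ → Z) (z : Z) :
    Set (TangentSpace 𝓘(𝕜, EZ) z) :=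
  {v | ∃ c : 𝕜 → Γ, c 0 = G.unit (φ z) ∧ SmoothCurve (E := EΓ) 𝕜 c ∧
    (∀ᶠ ε in 𝓝 (0 : 𝕜), G.src (c ε) = φ z) ∧ HasVelocity (fun ε => act z (c ε)) z v}

/-- The tangent space at `m` of the `Γ`-orbit `F_m` of `m ∈ M`, that is, the orbit of `m` for the
right action `m · γ = tgt γ` on `M`. -/
def baseOrbitTangentVectors (m : M) : Set (TangentSpace 𝓘(𝕜, EM) m) :=
  G.orbitTangentVectors (fun m : M => m) (fun _ γ => G.tgt γ) m

/-- `R ⇉ L` is a Lie subgroupoid of `Γ ⇉ M`. -/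
structure IsLieSubgroupoid (R : Set Γ) (L : Set M) : Prop where
  submanifold_arrows : IsEmbeddedSubmanifold (E := EΓ) 𝕜 R
  submanifold_units : IsEmbeddedSubmanifold (E := EM) 𝕜 L
  src_mem : ∀ r ∈ R, G.src r ∈ L
  tgt_mem : ∀ r ∈ R, G.tgt r ∈ L
  unit_mem : ∀ m ∈ L, G.unit m ∈ R
  inv_mem : ∀ r ∈ R, G.inv r ∈ R
  mul_mem : ∀ r ∈ R, ∀ r' ∈ R, G.tgt r = G.src r' → G.mul r r' ∈ R
  submersion_src : IsSubmersionBetween (E := EΓ) (E' := EM) 𝕜 R (fun r => G.src r) L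
  submersion_tgt : IsSubmersionBetween (E := EΓ) (E' := EM) 𝕜 R (fun r => G.tgt r) L

/-- `R ⇉ L` is closed: `R` is a closed subset of `Γ_L^L`. -/
def IsClosedSubgroupoid (R : Set Γ) (L : Set M) : Prop :=
  IsClosed {γ : G.between L L | (γ : Γ) ∈ R}

/-- `L` intersects transversally the `Γ`-orbits contained in `S`. -/
def IntersectsTransversally (L S : Set M) : Prop :=
  ∀ m ∈ L ∩ S, tangentVectors (E := EM) 𝕜 S m =
    G.baseOrbitTangentVectors m + tangentVectors (E := EM) 𝕜 L m

/-- `R ⇉ L` is a Lie subgroupoid in `S`. -/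
structure IsLieSubgroupoidIn (R : Set Γ) (L S : Set M) : Prop where
  isLieSubgroupoid : G.IsLieSubgroupoid R L
  dense : L ⊆ closure (L ∩ S)
  transverse : G.IntersectsTransversally L S
  meets_orbits : ∀ m ∈ S, ∃ γ, G.src γ = m ∧ G.tgt γ ∈ L

/-- `R ⇉ L` is a Lie subgroupoid full in `S`. -/
def IsLieSubgroupoidFullIn (R : Set Γ) (L S : Set M) : Prop :=
  G.IsLieSubgroupoidIn R L S ∧ R ∩ G.between (L ∩ S) (L ∩ S) = G.between (L ∩ S) (L ∩ S)

/-- `(Z, φ)` is `L`-compatible (relatively to `S`), with transversal submanifold `L' ⊆ Z`. -/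
structure IsCompatible (S : Set M) (φ : Z → M) (act : Z → Γ → Z) (L : Set M) (L' : Set Z) :
    Prop where
  submanifold : IsEmbeddedSubmanifold (E := EZ) 𝕜 L'
  diffeo : IsDiffeoBetween (E := EZ) (E' := EM) 𝕜 φ L' L
  transverse : ∀ z ∈ L',
    tangentVectors (E := EZ) 𝕜 L' z + G.orbitTangentVectors φ act z = Set.univ
  meets_orbits : ∀ z, φ z ∈ S → ∃ γ, G.src γ = φ z ∧ act z γ ∈ L'

/-- The `Γ`-orbit of a subset of a right module. -/
def orbitOf (φ : Z → M) (act : Z → Γ → Z) (A : Set Z) : Set Z :=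
  {w | ∃ z ∈ A, ∃ γ, φ z = G.src γ ∧ w = act z γ}

/-- The set of arrows `r ∈ Γ_L` with `ψ (src r) · r ∈ L'`. -/
def returnArrows (act : Z → Γ → Z) (L : Set M) (L' : Set Z) (ψ : L → Z) : Set Γ :=
  {r | ∃ h : G.src r ∈ L, act (ψ ⟨G.src r, h⟩) r ∈ L'}

/-- The quotient space `Z(R) = R \ Γ_L`, which identifies `γ` with `r γ` for `r ∈ R`. It carries the
quotient topology. -/
abbrev LeftQuotient (R : Set Γ) (L : Set M) : Type _ :=
  Quot (fun γ' γ : G.srcIn L => ∃ r ∈ R, G.tgt r = G.src γ ∧ (γ' : Γ) = G.mul r γ)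

/-- The class in `Z(R)` of an element of `Γ_L`. -/
def toLeftQuotient (R : Set Γ) (L : Set M) (γ : G.srcIn L) : G.LeftQuotient R L := Quot.mk _ γ

/-- The map `φ_R : Z(R) → M` induced by the target map. -/
def leftQuotientMap (R : Set Γ) (L : Set M) : G.LeftQuotient R L → M :=
  Quot.lift (fun γ => G.tgt γ) (by
    rintro γ' γ ⟨r, -, h, h'⟩
    show G.tgt γ' = G.tgt γ
    rw [h', G.tgt_mul r γ h])

/-- The given charts and action are the manifold structure and the right action of `Γ` on the
quotient `Z(R) = R \ Γ_L`: the projection `Γ_L → Z(R)` is a submersion, and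
`[γ] · γ' = [γ γ']`. -/
structure IsQuotientModule (R : Set Γ) (L : Set M) [ChartedSpace EZ (G.LeftQuotient R L)]
    (act : G.LeftQuotient R L → Γ → G.LeftQuotient R L) : Prop where
  isManifold : IsManifold 𝓘(𝕜, EZ) ∞ (G.LeftQuotient R L)
  t2 : T2Space (G.LeftQuotient R L)
  smooth_proj : SmoothOnSubset 𝓘(𝕜, EΓ) 𝓘(𝕜, EZ) (G.srcIn L) (G.toLeftQuotient R L)
  submersion_proj : IsSubmersionBetween (E := EΓ) (E' := EZ) 𝕜
    (G.srcIn L) (G.toLeftQuotient R L) Set.univ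
  act_proj : ∀ (γ : G.srcIn L) (γ' : Γ) (h : G.tgt γ = G.src γ'),
    act (G.toLeftQuotient R L γ) γ' =
      G.toLeftQuotient R L ⟨G.mul γ γ', by
        show G.src (G.mul γ γ') ∈ L
        rw [G.src_mul γ γ' h]
        exact γ.2⟩

/-- `Φ` is an isomorphism from the `Γ`-module `(W, φW)` onto the open subset `U` of the `Γ`-module
`(Z, φ)`: an equivariant diffeomorphism `W → U` over `M`. With `U = Z`, for two `Γ`-resolutions,
it is an isomorphism of `Γ`-resolutions. -/
structure IsModuleIsoOnto {W : Type*} [TopologicalSpace W] [ChartedSpace EZ W]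
    (φW : W → M) (actW : W → Γ → W) (φ : Z → M) (act : Z → Γ → Z) (Φ : W → Z) (U : Set Z) :
    Prop where
  isOpen : IsOpen U
  diffeo : IsDiffeoBetween (E := EZ) (E' := EZ) 𝕜 Φ Set.univ U
  map_comp : ∀ w, φ (Φ w) = φW w
  equivariant : ∀ w γ, φW w = G.src γ → Φ (actW w γ) = act (Φ w) γ

end LieGroupoid

/-! The proof rests on the map `Γ_L → Z`, `γ ↦ ψ (src γ) · γ` (`translate`). At a unit, its
differential reaches `T L'`, by moving the unit along `L`, and the directions of the `Γ`-orbit, so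
it is onto by transversality; right translation carries this over to the other arrows. Its fibres
are the classes of `R \ Γ_L` and its image is `L' · Γ`, so it induces an open embedding
`Z(R) → Z`, along which the manifold structure and the resolution are pulled back.

The set `R` is the preimage of `L'` under the same map. At an arrow `r ∈ R` the directions of the
orbit are images of vectors in `ker ds`, so that `(src, translate)` is transverse to `M × L'`: hence
`R` is a submanifold and `src : R → L` is a submersion. It is closed because it is the equaliser of
`translate` and `ψ ∘ tgt` on `Γ_L^L`, and full in `S` because `φ` is injective over `S`. -/

section LinearAlgebra

theorem finrank_comap_add_finrank_of_surjective {K E V : Type*} [DivisionRing K] [AddCommGroup E]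
    [Module K E] [FiniteDimensional K E] [AddCommGroup V] [Module K V] {π : E →ₗ[K] V}
    (hπ : Function.Surjective π) (W : Submodule K V) :
    Module.finrank K (W.comap π) + Module.finrank K V =
      Module.finrank K E + Module.finrank K W := by
  have := Module.Finite.of_surjective π hπ
  have hker := (W.mkQ ∘ₗ π).finrank_range_add_finrank_ker
  have hrange : (W.mkQ ∘ₗ π).range = ⊤ :=
    LinearMap.range_eq_top.2 (W.mkQ_surjective.comp hπ)
  rw [hrange, LinearMap.ker_comp, Submodule.ker_mkQ, finrank_top] at hker
  have hquot := W.finrank_quotient_add_finrank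
  omega

variable {𝕜 E : Type*} [NontriviallyNormedField 𝕜] [CompleteSpace 𝕜]
  [NormedAddCommGroup E] [NormedSpace 𝕜 E] [FiniteDimensional 𝕜 E]

theorem exists_continuousLinearMap_ker_eq (F : Submodule 𝕜 E) :
    ∃ (C : Submodule 𝕜 E) (p : E →L[𝕜] C), Function.Surjective p ∧ ∀ u, p u = 0 ↔ u ∈ F := by
  obtain ⟨C, hC⟩ := F.exists_isCompl
  exact ⟨C, (C.projectionOnto F hC.symm).toContinuousLinearMap,
    Submodule.projectionOnto_surjective hC.symm,
    fun _ => Submodule.projectionOnto_apply_eq_zero_iff hC.symm⟩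

theorem exists_continuousLinearEquiv_mem_iff {F F' : Submodule 𝕜 E}
    (h : Module.finrank 𝕜 F = Module.finrank 𝕜 F') :
    ∃ g : E ≃L[𝕜] E, ∀ u, u ∈ F ↔ g u ∈ F' := by
  obtain ⟨C, hC⟩ := F.exists_isCompl
  obtain ⟨C', hC'⟩ := F'.exists_isCompl
  have hdim := Submodule.finrank_add_eq_of_isCompl hC
  have hdim' := Submodule.finrank_add_eq_of_isCompl hC'
  let a : F ≃ₗ[𝕜] F' := LinearEquiv.ofFinrankEq F F' h
  let b : C ≃ₗ[𝕜] C' := LinearEquiv.ofFinrankEq C C' (by omega)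
  let g := (Submodule.prodEquivOfIsCompl F C hC).symm ≪≫ₗ a.prodCongr b ≪≫ₗ
    Submodule.prodEquivOfIsCompl F' C' hC'
  refine ⟨g.toContinuousLinearEquiv, fun u => ?_⟩
  have hg : ((Submodule.prodEquivOfIsCompl F' C' hC').symm (g u)).2 =
      b ((Submodule.prodEquivOfIsCompl F C hC).symm u).2 := by
    simp only [g, LinearEquiv.trans_apply, LinearEquiv.symm_apply_apply,
      LinearEquiv.prodCongr_apply]
  rw [← Submodule.prodEquivOfIsCompl_symm_apply_snd_eq_zero F C hC, ← b.map_eq_zero_iff, ← hg,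
    Submodule.prodEquivOfIsCompl_symm_apply_snd_eq_zero]
  rfl

end LinearAlgebra

section InverseFunction

variable {𝕜 : Type*} [RCLike 𝕜] {E V : Type*} [NormedAddCommGroup E] [NormedSpace 𝕜 E]
  [NormedAddCommGroup V] [NormedSpace 𝕜 V] {n : ℕ∞ω}

theorem exists_openPartialHomeomorph_contDiffOn_symm [CompleteSpace E] {f : E → V} {O : Set E}
    (hO : IsOpen O) {x : E} (hx : x ∈ O) (hn : 1 ≤ n) (hf : ContDiffOn 𝕜 n f O)
    {f' : E ≃L[𝕜] V} (hf' : HasFDerivAt f (f' : E →L[𝕜] V) x) :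
    ∃ θ : OpenPartialHomeomorph E V, x ∈ θ.source ∧ θ.source ⊆ O ∧ ⇑θ = f ∧
      ContDiffOn 𝕜 n θ.symm θ.target := by
  have hn₀ : n ≠ 0 := (zero_lt_one.trans_le hn).ne'
  have hfx : ContDiffAt 𝕜 n f x := hf.contDiffAt (hO.mem_nhds hx)
  let N : Set E := O ∩ fderiv 𝕜 f ⁻¹' Set.range ((↑) : (E ≃L[𝕜] V) → E →L[𝕜] V)
  have hN : IsOpen N :=
    (hf.continuousOn_fderiv_of_isOpen hO hn).isOpen_inter_preimage hO ContinuousLinearEquiv.isOpen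
  let θ := (hfx.toOpenPartialHomeomorph f hf' hn₀).restrOpen N hN
  refine ⟨θ, ⟨hfx.mem_toOpenPartialHomeomorph_source hf' hn₀, hx, f', hf'.fderiv.symm⟩,
    fun y hy => hy.2.1, rfl, fun y hy => ContDiffAt.contDiffWithinAt ?_⟩
  obtain ⟨-, hyO, g', hg'⟩ : θ.symm y ∈ θ.source := θ.map_target hy
  have hfy : ContDiffAt 𝕜 n f (θ.symm y) := hf.contDiffAt (hO.mem_nhds hyO)
  refine θ.contDiffAt_symm (f₀' := g') hy ?_ hfy
  rw [hg']
  exact (hfy.differentiableAt hn₀).hasFDerivAt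

theorem exists_openPartialHomeomorph_linear_of_surjective [FiniteDimensional 𝕜 E]
    [FiniteDimensional 𝕜 V] {f : E → V} {O : Set E} (hO : IsOpen O) {x : E} (hx : x ∈ O)
    (hn : 1 ≤ n) (hf : ContDiffOn 𝕜 n f O) {π : E →L[𝕜] V} (hf' : HasFDerivAt f π x)
    (hπ : Function.Surjective π) :
    ∃ θ : OpenPartialHomeomorph E E, x ∈ θ.source ∧ θ.source ⊆ O ∧
      ContDiffOn 𝕜 n θ θ.source ∧ ContDiffOn 𝕜 n θ.symm θ.target ∧ ∀ y, π (θ y) = f y := by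
  have := FiniteDimensional.complete 𝕜 E
  obtain ⟨q, hq⟩ := π.exists_rightInverse_of_surjective (LinearMap.range_eq_top.2 hπ)
  have hq (v : V) : π (q v) = v := DFunLike.congr_fun hq v
  -- `T` has derivative `id` at `x`, and `π ∘ T = f`.
  let T : E → E := fun u => u + q (f u - π u)
  have hT : ContDiffOn 𝕜 n T O :=
    contDiffOn_id.add (q.contDiff.comp_contDiffOn (hf.sub π.contDiff.contDiffOn))
  have hT' : HasFDerivAt T (ContinuousLinearEquiv.refl 𝕜 E : E →L[𝕜] E) x :=
    ((hasFDerivAt_id x).add (q.hasFDerivAt.comp x (hf'.sub π.hasFDerivAt))).congr_fderiv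
      (by ext; simp)
  obtain ⟨θ, hxθ, hθO, hθT, hθ⟩ :=
    exists_openPartialHomeomorph_contDiffOn_symm hO hx hn hT hT'
  refine ⟨θ, hxθ, hθO, hθT ▸ hT.mono hθO, hθ, fun y => ?_⟩
  simp only [hθT, T, map_add, hq, add_sub_cancel]

variable {X : Type*} [TopologicalSpace X] [ChartedSpace E X] [FiniteDimensional 𝕜 E]
  [FiniteDimensional 𝕜 V]

theorem exists_mem_maximalAtlas_linear_of_surjective_mfderiv [IsManifold 𝓘(𝕜, E) n X]
    (hn : 1 ≤ n) {f : X → V} {U : Set X} (hU : IsOpen U) {x : X} (hx : x ∈ U)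
    (hf : ContMDiffOn 𝓘(𝕜, E) 𝓘(𝕜, V) n f U)
    (hf' : Function.Surjective (mfderiv 𝓘(𝕜, E) 𝓘(𝕜, V) f x)) :
    ∃ e ∈ IsManifold.maximalAtlas 𝓘(𝕜, E) n X, x ∈ e.source ∧ e.source ⊆ U ∧
      ∃ π : E →L[𝕜] V, Function.Surjective π ∧ ∀ y ∈ e.source, π (e y) = f y := by
  let c := chartAt E x
  have hc : c ∈ IsManifold.maximalAtlas 𝓘(𝕜, E) n X := IsManifold.chart_mem_maximalAtlas x
  have hxc : x ∈ c.source := mem_chart_source E x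
  have hcx : c x ∈ c.target ∩ c.symm ⁻¹' U :=
    ⟨c.map_source hxc, by rwa [Set.mem_preimage, c.left_inv hxc]⟩
  have hfc : ContDiffOn 𝕜 n (f ∘ c.symm) (c.target ∩ c.symm ⁻¹' U) :=
    contMDiffOn_iff_contDiffOn.1 <|
      hf.comp ((contMDiffOn_symm_of_mem_maximalAtlas hc).mono Set.inter_subset_left)
        Set.inter_subset_right
  have hfc' : HasFDerivAt (f ∘ c.symm) (mfderiv 𝓘(𝕜, E) 𝓘(𝕜, V) f x : E →L[𝕜] V) (c x) := by
    have hfx := (hf.contMDiffAt (hU.mem_nhds hx)).mdifferentiableAt (zero_lt_one.trans_le hn).ne'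
    have hd := hfx.hasMFDerivAt.2
    simp only [writtenInExtChartAt, mfld_simps] at hd
    exact hasFDerivWithinAt_univ.1 hd
  obtain ⟨θ, hxθ, hθU, hθ, hθs, hθf⟩ := exists_openPartialHomeomorph_linear_of_surjective
    (c.symm.isOpen_inter_preimage hU) hcx hn hfc hfc' hf'
  have mem_source {y : X} : y ∈ (c.trans θ).source ↔ y ∈ c.source ∧ c y ∈ θ.source := by
    rw [OpenPartialHomeomorph.trans_source, Set.mem_inter_iff, Set.mem_preimage]
  refine ⟨c.trans θ, ?_, mem_source.2 ⟨hxc, hxθ⟩, fun y hy => ?_, _, hf', fun y hy => ?_⟩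
  · apply OpenPartialHomeomorph.mem_maximalAtlas_of_contMDiffOn
    · exact (contMDiffOn_iff_contDiffOn.2 hθ).comp
        ((contMDiffOn_of_mem_maximalAtlas hc).mono (by simp)) (by simp)
    · exact (contMDiffOn_symm_of_mem_maximalAtlas hc).comp
        ((contMDiffOn_iff_contDiffOn.2 hθs).mono (by simp)) (by simp)
  · obtain ⟨hyc, hyθ⟩ := mem_source.1 hy
    simpa only [Set.mem_preimage, c.left_inv hyc] using (hθU hyθ).2
  · rw [OpenPartialHomeomorph.coe_trans, Function.comp_apply, hθf, Function.comp_apply,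
      c.left_inv (mem_source.1 hy).1]

theorem exists_local_section_of_surjective_mfderiv [IsManifold 𝓘(𝕜, E) n X]
    (hn : 1 ≤ n) {f : X → V} {U : Set X} (hU : IsOpen U) {x : X} (hx : x ∈ U)
    (hf : ContMDiffOn 𝓘(𝕜, E) 𝓘(𝕜, V) n f U)
    (hf' : Function.Surjective (mfderiv 𝓘(𝕜, E) 𝓘(𝕜, V) f x)) :
    ∃ σ : V → X, ContMDiffAt 𝓘(𝕜, V) 𝓘(𝕜, E) n σ (f x) ∧ σ (f x) = x ∧
      ∀ᶠ v in 𝓝 (f x), f (σ v) = v := by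
  obtain ⟨e, he, hxe, -, π, hπ, hπe⟩ :=
    exists_mem_maximalAtlas_linear_of_surjective_mfderiv hn hU hx hf hf'
  obtain ⟨q, hq⟩ := π.exists_rightInverse_of_surjective (LinearMap.range_eq_top.2 hπ)
  have hq (v : V) : π (q v) = v := DFunLike.congr_fun hq v
  let s : V → E := fun v => e x + q (v - f x)
  have hs : ContDiff 𝕜 n s := contDiff_const.add (q.contDiff.comp (contDiff_id.sub contDiff_const))
  have hsx : s (f x) = e x := by simp only [s, sub_self, map_zero, add_zero]
  have hse : s (f x) ∈ e.target := hsx ▸ e.map_source hxe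
  refine ⟨e.symm ∘ s, ?_, ?_, ?_⟩
  · exact (contMDiffAt_symm_of_mem_maximalAtlas he hse).comp _ hs.contMDiff.contMDiffAt
  · rw [Function.comp_apply, hsx, e.left_inv hxe]
  · filter_upwards [hs.continuous.continuousAt.eventually (e.open_target.mem_nhds hse)] with v hv
    rw [Function.comp_apply, ← hπe _ (e.map_target hv), e.right_inv hv, map_add, hq, hπe x hxe,
      add_sub_cancel]

end InverseFunction

namespace SmoothOnSubset

variable {𝕜 : Type*} [RCLike 𝕜] {E H E' H' E'' H'' X Y N : Type*}
  [NormedAddCommGroup E] [NormedSpace 𝕜 E] [TopologicalSpace H] {I : ModelWithCorners 𝕜 E H}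
  [NormedAddCommGroup E'] [NormedSpace 𝕜 E'] [TopologicalSpace H'] {J : ModelWithCorners 𝕜 E' H'}
  [NormedAddCommGroup E''] [NormedSpace 𝕜 E''] [TopologicalSpace H'']
  {K : ModelWithCorners 𝕜 E'' H''}
  [TopologicalSpace X] [ChartedSpace H X] [TopologicalSpace Y] [ChartedSpace H' Y]
  [TopologicalSpace N] [ChartedSpace H'' N] {A : Set X} {B : Set N} {f : A → Y}

theorem of_contMDiff {g : X → Y} (hg : ContMDiff I J ∞ g) :
    SmoothOnSubset I J A fun x => g x :=
  fun x => ⟨g, hg x, Filter.Eventually.of_forall fun _ => rfl⟩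

theorem continuous (hf : SmoothOnSubset I J A f) : Continuous f :=
  continuous_iff_continuousAt.2 fun x => by
    obtain ⟨g, hg, hgf⟩ := hf x
    exact (hg.continuousAt.comp continuousAt_subtype_val).congr hgf

theorem contMDiffAt_comp (hf : SmoothOnSubset I J A f) {k : N → X} {n : N}
    (hk : ContMDiffAt K I ∞ k n) {F : N → Y}
    (hF : ∀ᶠ m in 𝓝 n, ∃ h : k m ∈ A, F m = f ⟨k m, h⟩) : ContMDiffAt K J ∞ F n := by
  obtain ⟨hn, -⟩ := hF.self_of_nhds
  obtain ⟨g, hg, hgf⟩ := hf ⟨k n, hn⟩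
  refine (ContMDiffAt.comp n hg hk).congr_of_eventuallyEq ?_
  rw [nhds_subtype_eq_comap, Filter.eventually_comap] at hgf
  filter_upwards [hF, hk.continuousAt.eventually hgf] with m ⟨hm, hFm⟩ hgm
  rw [hFm, Function.comp_apply, hgm ⟨k m, hm⟩ rfl]

theorem comp (hf : SmoothOnSubset I J A f) {k : B → X} (hk : SmoothOnSubset K I B k)
    (h : ∀ b, k b ∈ A) : SmoothOnSubset K J B fun b => f ⟨k b, h b⟩ := fun b => by
  obtain ⟨g, hg, hgf⟩ := hf ⟨k b, h b⟩
  obtain ⟨l, hl, hlk⟩ := hk b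
  have hlb : l b = k b := hlk.self_of_nhds
  refine ⟨g ∘ l, ContMDiffAt.comp _ (by rwa [hlb]) hl, ?_⟩
  have hkA : ContinuousAt (fun b => (⟨k b, h b⟩ : A)) b := (hk.continuous.subtype_mk h).continuousAt
  filter_upwards [hlk, hkA.eventually hgf] with b' hlb' hgb'
  rw [Function.comp_apply, hlb', hgb']

theorem prodMk {f : B → X} {g : B → Y} (hf : SmoothOnSubset K I B f)
    (hg : SmoothOnSubset K J B g) : SmoothOnSubset K (I.prod J) B fun b => (f b, g b) := fun b => by
  obtain ⟨k, hk, hkf⟩ := hf b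
  obtain ⟨l, hl, hlg⟩ := hg b
  refine ⟨fun x => (k x, l x), hk.prodMk hl, ?_⟩
  filter_upwards [hkf, hlg] with b' hkb hlb
  rw [hkb, hlb]

end SmoothOnSubset

section Velocity

variable {𝕜 : Type*} [RCLike 𝕜] {E X E' Y : Type*} [NormedAddCommGroup E] [NormedSpace 𝕜 E]
  [TopologicalSpace X] [ChartedSpace E X]
  [NormedAddCommGroup E'] [NormedSpace 𝕜 E'] [TopologicalSpace Y] [ChartedSpace E' Y]
  {c c' : 𝕜 → X} {x : X} {v w : TangentSpace 𝓘(𝕜, E) x} {f : X → Y}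

theorem SmoothCurve.mdifferentiableAt (hc : SmoothCurve (E := E) 𝕜 c) :
    MDifferentiableAt 𝓘(𝕜, 𝕜) 𝓘(𝕜, E) c 0 :=
  ContMDiffAt.mdifferentiableAt hc (by simp)

theorem hasVelocity_mfderiv (c : 𝕜 → X) :
    HasVelocity c (c 0) (mfderiv 𝓘(𝕜, 𝕜) 𝓘(𝕜, E) c 0 (1 : 𝕜)) :=
  rfl

theorem exists_hasVelocity (hx : c 0 = x) : ∃ v : TangentSpace 𝓘(𝕜, E) x, HasVelocity c x v := by
  obtain rfl := hx
  exact ⟨_, hasVelocity_mfderiv c⟩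

namespace HasVelocity

theorem base (h : HasVelocity c x v) : c 0 = x :=
  congrArg Bundle.TotalSpace.proj h

theorem mfderiv_one {v : TangentSpace 𝓘(𝕜, E) (c 0)} (h : HasVelocity c (c 0) v) :
    mfderiv 𝓘(𝕜, 𝕜) 𝓘(𝕜, E) c 0 (1 : 𝕜) = v :=
  Bundle.TotalSpace.mk_inj.1 h

theorem unique (hv : HasVelocity c x v) (hw : HasVelocity c x w) : v = w :=
  Bundle.TotalSpace.mk_inj.1 (hv.symm.trans hw)

theorem congr (h : HasVelocity c x v) (hc : c' =ᶠ[𝓝 0] c) : HasVelocity c' x v := by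
  have hd : (mfderiv 𝓘(𝕜, 𝕜) 𝓘(𝕜, E) c' 0 : 𝕜 →L[𝕜] E) = mfderiv 𝓘(𝕜, 𝕜) 𝓘(𝕜, E) c 0 :=
    hc.mfderiv_eq
  obtain rfl := h.base
  exact Bundle.TotalSpace.ext hc.self_of_nhds
    (heq_of_eq ((DFunLike.congr_fun hd (1 : 𝕜)).trans h.mfderiv_one))

theorem comp (h : HasVelocity c x v) (hc : SmoothCurve (E := E) 𝕜 c)
    (hf : MDifferentiableAt 𝓘(𝕜, E) 𝓘(𝕜, E') f x) :
    HasVelocity (fun ε => f (c ε)) (f x) (mfderiv 𝓘(𝕜, E) 𝓘(𝕜, E') f x v) := by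
  obtain rfl := h.base
  exact (tangentMap_comp_at (⟨0, (1 : 𝕜)⟩ : TangentBundle 𝓘(𝕜, 𝕜) 𝕜) hf
    hc.mdifferentiableAt).trans (congrArg (tangentMap 𝓘(𝕜, E) 𝓘(𝕜, E') f) h)

theorem mfderiv_eq (hv : HasVelocity c x v) (hc : SmoothCurve (E := E) 𝕜 c)
    (hf : MDifferentiableAt 𝓘(𝕜, E) 𝓘(𝕜, E') f x) {k : 𝕜 → Y}
    {w : TangentSpace 𝓘(𝕜, E') (f x)} (hk : HasVelocity k (f x) w)
    (hfk : ∀ᶠ ε in 𝓝 0, f (c ε) = k ε) : mfderiv 𝓘(𝕜, E) 𝓘(𝕜, E') f x v = w :=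
  (hv.comp hc hf).unique (hk.congr hfk)

end HasVelocity

theorem hasVelocity_of_hasDerivAt {c : 𝕜 → E} {v : E} (h : HasDerivAt c v 0) :
    HasVelocity c (c 0) (v : TangentSpace 𝓘(𝕜, E) (c 0)) := by
  rw [← h.deriv, ← fderiv_apply_one_eq_deriv, ← mfderiv_eq_fderiv]
  exact hasVelocity_mfderiv c

theorem HasVelocity.hasDerivAt {c : 𝕜 → E} {x v : E}
    (h : HasVelocity c x (v : TangentSpace 𝓘(𝕜, E) x)) (hc : SmoothCurve (E := E) 𝕜 c) :
    HasDerivAt c v 0 := by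
  obtain rfl := h.base
  have hd : HasDerivAt c (mfderiv 𝓘(𝕜, 𝕜) 𝓘(𝕜, E) c 0 (1 : 𝕜) : E) 0 := by
    rw [mfderiv_eq_fderiv]
    exact hc.mdifferentiableAt.differentiableAt.hasFDerivAt.hasDerivAt
  exact hd.congr_deriv h.mfderiv_one

end Velocity

section Submanifold

variable {𝕜 : Type*} [RCLike 𝕜] {E X E' Y : Type*} [NormedAddCommGroup E] [NormedSpace 𝕜 E]
  [TopologicalSpace X] [ChartedSpace E X]
  [NormedAddCommGroup E'] [NormedSpace 𝕜 E'] [TopologicalSpace Y] [ChartedSpace E' Y]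
  {A : Set X} {B : Set Y} {x : X} {f : X → Y}

theorem mfderiv_mem_tangentVectors {v : TangentSpace 𝓘(𝕜, E) x}
    (hf : ContMDiffAt 𝓘(𝕜, E) 𝓘(𝕜, E') ∞ f x) (hAB : ∀ᶠ y in 𝓝 x, y ∈ A → f y ∈ B)
    (hv : v ∈ tangentVectors 𝕜 A x) :
    mfderiv 𝓘(𝕜, E) 𝓘(𝕜, E') f x v ∈ tangentVectors 𝕜 B (f x) := by
  obtain ⟨c, hc, hcA, hcv⟩ := hv
  obtain rfl := hcv.base
  refine ⟨fun ε => f (c ε), ContMDiffAt.comp 0 hf hc, ?_,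
    hcv.comp hc (hf.mdifferentiableAt (by simp))⟩
  filter_upwards [hcA, ContMDiffAt.continuousAt hc |>.eventually hAB] with ε hε hAB
  exact hAB hε

theorem mdifferentiable_of_mem_maximalAtlas
    {e : OpenPartialHomeomorph X E} (he : e ∈ IsManifold.maximalAtlas 𝓘(𝕜, E) ∞ X) :
    e.MDifferentiable 𝓘(𝕜, E) 𝓘(𝕜, E) :=
  ⟨(contMDiffOn_of_mem_maximalAtlas he).mdifferentiableOn (by simp),
    (contMDiffOn_symm_of_mem_maximalAtlas he).mdifferentiableOn (by simp)⟩

theorem exists_smoothCurve_of_mem_maximalAtlas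
    {e : OpenPartialHomeomorph X E} (he : e ∈ IsManifold.maximalAtlas 𝓘(𝕜, E) ∞ X)
    (hx : x ∈ e.source) {v : TangentSpace 𝓘(𝕜, E) x} {w : E}
    (hvw : mfderiv 𝓘(𝕜, E) 𝓘(𝕜, E) e x v = w) :
    ∃ c : 𝕜 → X, SmoothCurve (E := E) 𝕜 c ∧ HasVelocity c x v ∧
      ∀ᶠ ε in 𝓝 (0 : 𝕜), c ε ∈ e.source ∧ e (c ε) = e x + ε • w := by
  let l : 𝕜 → E := fun ε => e x + ε • w
  have hl : ContDiff 𝕜 ∞ l := contDiff_const.add (contDiff_id.smul contDiff_const)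
  have hl₀ : l 0 = e x := by simp only [l, zero_smul, add_zero]
  have hl' : HasDerivAt l w 0 := by
    simpa only [one_smul] using ((hasDerivAt_id' (0 : 𝕜)).smul_const w).const_add (e x)
  have hle : ∀ᶠ ε in 𝓝 0, l ε ∈ e.target := hl.continuous.continuousAt.eventually
    (e.open_target.mem_nhds (hl₀ ▸ e.map_source hx))
  have hc : SmoothCurve (E := E) 𝕜 (e.symm ∘ l) :=
    (contMDiffAt_symm_of_mem_maximalAtlas he hle.self_of_nhds).comp 0 hl.contMDiff.contMDiffAt
  obtain ⟨v', hv'⟩ : ∃ v' : TangentSpace 𝓘(𝕜, E) x, HasVelocity (e.symm ∘ l) x v' :=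
    exists_hasVelocity (by rw [Function.comp_apply, hl₀, e.left_inv hx])
  refine ⟨e.symm ∘ l, hc, ?_, hle.mono fun ε hε => ⟨e.map_target hε, e.right_inv hε⟩⟩
  have hdv' : mfderiv 𝓘(𝕜, E) 𝓘(𝕜, E) e x v' = w :=
    hv'.mfderiv_eq hc ((mdifferentiable_of_mem_maximalAtlas he).mdifferentiableAt hx)
      (hl₀ ▸ hasVelocity_of_hasDerivAt hl') (hle.mono fun ε hε => e.right_inv hε)
  rwa [(mdifferentiable_of_mem_maximalAtlas he).mfderiv_injective hx (hvw.trans hdv'.symm)]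

theorem mem_of_mem_tangentVectors_submodule [FiniteDimensional 𝕜 E] {F : Submodule 𝕜 E} {x : E}
    {v : E} (hv : v ∈ tangentVectors (E := E) 𝕜 (F : Set E) x) : v ∈ F := by
  obtain ⟨C, p, -, hp⟩ := exists_continuousLinearMap_ker_eq F
  obtain ⟨c, hc, hcF, hcv⟩ := hv
  rw [← hp]
  refine (p.hasFDerivAt.comp_hasDerivAt 0 (hcv.hasDerivAt hc)).unique
    ((hasDerivAt_const 0 0).congr_of_eventuallyEq ?_)
  filter_upwards [hcF] with ε hε
  exact (hp _).2 hε

end Submanifold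

/-- The chart `e` straightens `A` around `x` to the linear subspace `F`. -/
structure IsSliceChart {𝕜 : Type*} [RCLike 𝕜] {E X : Type*} [NormedAddCommGroup E]
    [NormedSpace 𝕜 E] [TopologicalSpace X] [ChartedSpace E X]
    (A : Set X) (x : X) (e : OpenPartialHomeomorph X E) (F : Submodule 𝕜 E) : Prop where
  mem_maximalAtlas : e ∈ IsManifold.maximalAtlas 𝓘(𝕜, E) ∞ X
  mem_source : x ∈ e.source
  mem_iff : ∀ y ∈ e.source, (y ∈ A ↔ e y ∈ F)

section SliceChart

variable {𝕜 : Type*} [RCLike 𝕜] {E X E' Y V : Type*} [NormedAddCommGroup E] [NormedSpace 𝕜 E]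
  [TopologicalSpace X] [ChartedSpace E X]
  [NormedAddCommGroup E'] [NormedSpace 𝕜 E'] [TopologicalSpace Y] [ChartedSpace E' Y]
  [NormedAddCommGroup V] [NormedSpace 𝕜 V]
  {A : Set X} {x : X} {e : OpenPartialHomeomorph X E} {F : Submodule 𝕜 E}

theorem IsEmbeddedSubmanifold.exists_isSliceChart (hA : IsEmbeddedSubmanifold (E := E) 𝕜 A) :
    ∃ F : Submodule 𝕜 E, ∀ x ∈ A, ∃ e : OpenPartialHomeomorph X E, IsSliceChart A x e F := by
  obtain ⟨F, hF⟩ := hA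
  refine ⟨F, fun x hx => ?_⟩
  obtain ⟨e, he, hxe, heF⟩ := hF x hx
  exact ⟨e, he, hxe, heF⟩

theorem isEmbeddedSubmanifold_of_finrank [FiniteDimensional 𝕜 E] [IsManifold 𝓘(𝕜, E) ∞ X] (d : ℕ)
    (h : ∀ x ∈ A, ∃ (e : OpenPartialHomeomorph X E) (F : Submodule 𝕜 E),
      Module.finrank 𝕜 F = d ∧ IsSliceChart A x e F) :
    IsEmbeddedSubmanifold (E := E) 𝕜 A := by
  rcases A.eq_empty_or_nonempty with rfl | ⟨x₀, hx₀⟩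
  · exact ⟨⊥, fun x hx => hx.elim⟩
  obtain ⟨-, F₀, hF₀, -⟩ := h x₀ hx₀
  refine ⟨F₀, fun x hx => ?_⟩
  obtain ⟨e, F, hF, he⟩ := h x hx
  obtain ⟨g, hg⟩ := exists_continuousLinearEquiv_mem_iff (hF.trans hF₀.symm)
  refine ⟨e.transHomeomorph g.toHomeomorph, ?_, he.mem_source, fun y hy =>
    (he.mem_iff y hy).trans (hg _)⟩
  apply OpenPartialHomeomorph.mem_maximalAtlas_of_contMDiffOn
  · exact g.contDiff.contMDiff.comp_contMDiffOn
      (contMDiffOn_of_mem_maximalAtlas he.mem_maximalAtlas)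
  · exact (contMDiffOn_symm_of_mem_maximalAtlas he.mem_maximalAtlas).comp
      g.symm.contDiff.contMDiff.contMDiffOn fun y hy => hy

theorem exists_isSliceChart_of_surjective_mfderiv [FiniteDimensional 𝕜 E] [FiniteDimensional 𝕜 V]
    [IsManifold 𝓘(𝕜, E) ∞ X] {f : X → V} {U : Set X} (hU : IsOpen U) (hx : x ∈ U)
    (hf : ContMDiffOn 𝓘(𝕜, E) 𝓘(𝕜, V) ∞ f U)
    (hf' : Function.Surjective (mfderiv 𝓘(𝕜, E) 𝓘(𝕜, V) f x)) {W : Submodule 𝕜 V}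
    (hA : ∀ y ∈ U, (y ∈ A ↔ f y ∈ W)) :
    ∃ (e : OpenPartialHomeomorph X E) (F : Submodule 𝕜 E),
      Module.finrank 𝕜 F + Module.finrank 𝕜 V = Module.finrank 𝕜 E + Module.finrank 𝕜 W ∧
      IsSliceChart A x e F := by
  obtain ⟨e, he, hxe, heU, π, hπ, hπe⟩ :=
    exists_mem_maximalAtlas_linear_of_surjective_mfderiv (by simp) hU hx hf hf'
  refine ⟨e, W.comap (π : E →ₗ[𝕜] V), finrank_comap_add_finrank_of_surjective hπ W,
    he, hxe, fun y hy => ?_⟩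
  rw [hA y (heU hy), ← hπe y hy]
  rfl

namespace IsSliceChart

theorem mem_tangentVectors_iff [FiniteDimensional 𝕜 E]
    (he : IsSliceChart A x e F) (hx : x ∈ A) {v : TangentSpace 𝓘(𝕜, E) x} :
    v ∈ tangentVectors 𝕜 A x ↔ (mfderiv 𝓘(𝕜, E) 𝓘(𝕜, E) e x v : E) ∈ F := by
  constructor
  · intro hv
    refine mem_of_mem_tangentVectors_submodule (x := e x) (mfderiv_mem_tangentVectors
      (contMDiffAt_of_mem_maximalAtlas he.mem_maximalAtlas he.mem_source) ?_ hv)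
    filter_upwards [e.open_source.mem_nhds he.mem_source] with y hy
    exact (he.mem_iff y hy).1
  · intro hv
    obtain ⟨c, hc, hcv, hce⟩ :=
      exists_smoothCurve_of_mem_maximalAtlas he.mem_maximalAtlas he.mem_source (v := v) rfl
    refine ⟨c, hc, hce.mono fun ε ⟨hεe, hε⟩ => (he.mem_iff _ hεe).2 ?_, hcv⟩
    rw [hε]
    exact F.add_mem ((he.mem_iff x he.mem_source).1 hx) (F.smul_mem ε hv)

theorem exists_retraction [FiniteDimensional 𝕜 E] (he : IsSliceChart A x e F) (hx : x ∈ A) :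
    ∃ (U : Set X) (ρ : X → X), IsOpen U ∧ x ∈ U ∧ ContMDiffOn 𝓘(𝕜, E) 𝓘(𝕜, E) ∞ ρ U ∧
      Set.MapsTo ρ U A ∧ ∀ y ∈ U ∩ A, ρ y = y := by
  obtain ⟨F', hF'⟩ := F.exists_isCompl
  let P : E →L[𝕜] E := LinearMap.toContinuousLinearMap (F.projection F' hF')
  have hP (u : E) : P u ∈ F := Submodule.projection_apply_mem hF' u
  have hPF (u : E) (hu : u ∈ F) : P u = u := Submodule.projection_apply_of_mem_left hF' hu
  have heA := contMDiffOn_of_mem_maximalAtlas he.mem_maximalAtlas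
  refine ⟨e.source ∩ e ⁻¹' (P ⁻¹' e.target), fun y => e.symm (P (e y)),
    e.isOpen_inter_preimage (e.open_target.preimage P.continuous), ⟨he.mem_source, ?_⟩,
    (contMDiffOn_symm_of_mem_maximalAtlas he.mem_maximalAtlas).comp
      (P.contMDiff.comp_contMDiffOn (heA.mono Set.inter_subset_left)) Set.inter_subset_right,
    fun y hy => ?_, fun y hy => ?_⟩
  · rw [Set.mem_preimage, Set.mem_preimage, hPF _ ((he.mem_iff x he.mem_source).1 hx)]
    exact e.map_source he.mem_source
  · rw [he.mem_iff _ (e.map_target hy.2), e.right_inv hy.2]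
    exact hP _
  · change e.symm (P (e y)) = y
    rw [hPF _ ((he.mem_iff y hy.1.1).1 hy.2), e.left_inv hy.1.1]

end IsSliceChart

theorem IsEmbeddedSubmanifold.add_mem_tangentVectors [FiniteDimensional 𝕜 E]
    (hA : IsEmbeddedSubmanifold (E := E) 𝕜 A) (hx : x ∈ A)
    {v w : TangentSpace 𝓘(𝕜, E) x} (hv : v ∈ tangentVectors 𝕜 A x)
    (hw : w ∈ tangentVectors 𝕜 A x) : v + w ∈ tangentVectors 𝕜 A x := by
  obtain ⟨F, hF⟩ := hA.exists_isSliceChart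
  obtain ⟨e, he⟩ := hF x hx
  rw [he.mem_tangentVectors_iff hx] at hv hw ⊢
  rw [map_add]
  exact F.add_mem hv hw

theorem IsEmbeddedSubmanifold.eventually_mem_of_mem_closure [FiniteDimensional 𝕜 E]
    (hA : IsEmbeddedSubmanifold (E := E) 𝕜 A) (hx : x ∈ A) :
    ∀ᶠ y in 𝓝 x, y ∈ closure A → y ∈ A := by
  obtain ⟨F, hF⟩ := hA.exists_isSliceChart
  obtain ⟨e, he⟩ := hF x hx
  have hFc : IsClosed (F : Set E) := F.closed_of_finiteDimensional
  filter_upwards [e.open_source.mem_nhds he.mem_source] with y hy hyA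
  by_contra hyA'
  have hyF : e y ∉ F := (he.mem_iff y hy).not.1 hyA'
  obtain ⟨z, ⟨hz, hzF⟩, hzA⟩ := mem_closure_iff_nhds.1 hyA _
    ((e.isOpen_inter_preimage hFc.isOpen_compl).mem_nhds ⟨hy, hyF⟩)
  exact hzF ((he.mem_iff z hz).1 hzA)

theorem SmoothOnSubset.exists_contMDiffOn [FiniteDimensional 𝕜 E]
    (hA : IsEmbeddedSubmanifold (E := E) 𝕜 A) {f : A → Y}
    (hf : SmoothOnSubset 𝓘(𝕜, E) 𝓘(𝕜, E') A f) (x : A) :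
    ∃ (g : X → Y) (U : Set X), IsOpen U ∧ (x : X) ∈ U ∧ ContMDiffOn 𝓘(𝕜, E) 𝓘(𝕜, E') ∞ g U ∧
      ∀ y : A, (y : X) ∈ U → g y = f y := by
  classical
  obtain ⟨F, hF⟩ := hA.exists_isSliceChart
  obtain ⟨e, he⟩ := hF x x.2
  obtain ⟨U, ρ, hU, hxU, hρ, hρA, hρid⟩ := he.exists_retraction x.2
  refine ⟨fun y => if h : ρ y ∈ A then f ⟨ρ y, h⟩ else f x, U, hU, hxU, fun y hy => ?_,
    fun y hy => ?_⟩
  · refine (hf.contMDiffAt_comp (hρ.contMDiffAt (hU.mem_nhds hy)) ?_).contMDiffWithinAt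
    filter_upwards [hU.mem_nhds hy] with z hz
    exact ⟨hρA hz, dif_pos (hρA hz)⟩
  · simp only [hρid y ⟨hy, y.2⟩, Subtype.coe_prop, dif_pos]

end SliceChart

section LocalSections

variable {𝕜 : Type*} [RCLike 𝕜] {E X E' Y : Type*} [NormedAddCommGroup E] [NormedSpace 𝕜 E]
  [TopologicalSpace X] [ChartedSpace E X]
  [NormedAddCommGroup E'] [NormedSpace 𝕜 E'] [TopologicalSpace Y] [ChartedSpace E' Y]
  {A : Set X} {B : Set Y} {x : X} {f : X → Y}

theorem exists_local_section_of_isSubmersionAt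
    (hf : Manifold.IsSubmersionAt 𝓘(𝕜, E) 𝓘(𝕜, E') ∞ f x) :
    ∃ σ : Y → X, ContMDiffAt 𝓘(𝕜, E') 𝓘(𝕜, E) ∞ σ (f x) ∧ σ (f x) = x ∧
      ∀ᶠ y in 𝓝 (f x), f (σ y) = y := by
  have h := hf.isSubmersionAtOfComplement_complement
  set d := h.domChart
  set c := h.codChart
  have hx : x ∈ d.source := h.mem_domChart_source
  have hfx : f x ∈ c.source := h.mem_codChart_source
  have hfd (u : E) (hu : u ∈ d.target) : c (f (d.symm u)) = (h.equiv u).1 :=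
    h.writtenInCharts (by rwa [h.domChart.extend_target, modelWithCornersSelf_coe_symm,
      Set.preimage_id, modelWithCornersSelf_coe, Set.range_id, Set.inter_univ])
  let s : E' → E := fun y => h.equiv.symm (y, (h.equiv (d x)).2)
  have hs : ContDiff 𝕜 ∞ s := h.equiv.symm.contDiff.comp (contDiff_id.prodMk contDiff_const)
  have hsx : s (c (f x)) = d x := by
    have hdx := hfd (d x) (d.map_source hx)
    rw [d.left_inv hx] at hdx
    simp only [s, hdx, Prod.mk.eta, ContinuousLinearEquiv.symm_apply_apply]
  have hsc : ContMDiffAt 𝓘(𝕜, E') 𝓘(𝕜, E) ∞ (fun y => s (c y)) (f x) :=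
    hs.comp_contMDiffAt (contMDiffAt_of_mem_maximalAtlas h.codChart_mem_maximalAtlas hfx)
  refine ⟨fun y => d.symm (s (c y)), ContMDiffAt.comp (f x) ?_ hsc, ?_, ?_⟩
  · exact contMDiffAt_symm_of_mem_maximalAtlas h.domChart_mem_maximalAtlas
      (hsx ▸ d.map_source hx)
  · simp only [hsx, d.left_inv hx]
  · have hsx' : d x = (fun y => s (c y)) (f x) := hsx.symm
    filter_upwards [hsc.continuousAt.eventually (d.open_target.mem_nhds
      (hsx' ▸ d.map_source hx)), c.open_source.mem_nhds hfx] with y hy hyc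
    refine c.injOn (h.source_subset_preimage_source (d.map_target hy)) hyc ?_
    rw [hfd _ hy, ContinuousLinearEquiv.apply_symm_apply]

theorem surjective_mfderiv_of_local_section (hf : MDifferentiableAt 𝓘(𝕜, E) 𝓘(𝕜, E') f x)
    {σ : Y → X} (hσ : MDifferentiableAt 𝓘(𝕜, E') 𝓘(𝕜, E) σ (f x)) (hσx : σ (f x) = x)
    (hfσ : ∀ᶠ y in 𝓝 (f x), f (σ y) = y) :
    Function.Surjective (mfderiv 𝓘(𝕜, E) 𝓘(𝕜, E') f x) := by
  have hid : mfderiv 𝓘(𝕜, E') 𝓘(𝕜, E') (f ∘ σ) (f x) = ContinuousLinearMap.id 𝕜 E' :=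
    (Filter.EventuallyEq.mfderiv_eq (f₁ := f ∘ σ) (f := id) hfσ).trans mfderiv_id
  refine fun w => ⟨mfderiv 𝓘(𝕜, E') 𝓘(𝕜, E) σ (f x) w, ?_⟩
  rw [← mfderiv_comp_apply_of_eq _ hf hσ hσx, hid]
  rfl

theorem IsEmbeddedSubmanifold.preimage [FiniteDimensional 𝕜 E] [FiniteDimensional 𝕜 E']
    [IsManifold 𝓘(𝕜, E) ∞ X]
    (hB : IsEmbeddedSubmanifold (E := E') 𝕜 B) (hf : ContMDiff 𝓘(𝕜, E) 𝓘(𝕜, E') ∞ f)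
    (hf' : ∀ x ∈ f ⁻¹' B, Function.Surjective (mfderiv 𝓘(𝕜, E) 𝓘(𝕜, E') f x)) :
    IsEmbeddedSubmanifold (E := E) 𝕜 (f ⁻¹' B) := by
  obtain ⟨F, hF⟩ := hB.exists_isSliceChart
  refine isEmbeddedSubmanifold_of_finrank
    (Module.finrank 𝕜 E + Module.finrank 𝕜 F - Module.finrank 𝕜 E') fun x hx => ?_
  obtain ⟨e, he⟩ := hF _ hx
  have he' := mdifferentiable_of_mem_maximalAtlas he.mem_maximalAtlas
  have hef' : Function.Surjective (mfderiv 𝓘(𝕜, E) 𝓘(𝕜, E') (e ∘ f) x) := by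
    rw [mfderiv_comp x (he'.mdifferentiableAt he.mem_source) (hf.mdifferentiableAt (by simp))]
    exact (he'.mfderiv_surjective he.mem_source).comp (hf' x hx)
  obtain ⟨e', F', hF', heF'⟩ := exists_isSliceChart_of_surjective_mfderiv
    (hf.continuous.isOpen_preimage _ e.open_source) he.mem_source
    ((contMDiffOn_of_mem_maximalAtlas he.mem_maximalAtlas).comp hf.contMDiffOn fun y hy => hy)
    hef' fun y hy => he.mem_iff (f y) hy
  exact ⟨e', F', by omega, heF'⟩

theorem isSubmersionBetween_of_local_section {f : A → Y}
    (h : ∀ x : A, ∃ σ : Y → X, ContMDiffAt 𝓘(𝕜, E') 𝓘(𝕜, E) ∞ σ (f x) ∧ σ (f x) = x ∧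
      ∀ᶠ y in 𝓝 (f x), y ∈ B → ∃ hy : σ y ∈ A, f ⟨σ y, hy⟩ = y) :
    IsSubmersionBetween (E := E) (E' := E') 𝕜 A f B := by
  classical
  rintro x v ⟨k, hk, hkB, hkv⟩
  obtain ⟨σ, hσ, hσx, hfσ⟩ := h x
  have hk₀ : k 0 = f x := hkv.base
  have hσk : ∀ᶠ ε in 𝓝 0, ∃ hε : σ (k ε) ∈ A, f ⟨σ (k ε), hε⟩ = k ε := by
    have hkx : Filter.Tendsto k (𝓝 0) (𝓝 (f x)) := hk₀ ▸ ContMDiffAt.continuousAt hk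
    filter_upwards [hkB, hkx.eventually hfσ] with ε hε hσε using hσε hε
  refine ⟨fun ε => if hε : σ (k ε) ∈ A then ⟨σ (k ε), hε⟩ else x, ?_, ?_, hkv.congr ?_⟩
  · simp only [hk₀, hσx, Subtype.coe_prop, dite_true]
  · refine ContMDiffAt.congr_of_eventuallyEq (ContMDiffAt.comp 0 (hk₀ ▸ hσ) hk) ?_
    filter_upwards [hσk] with ε ⟨hε, _⟩
    rw [dif_pos hε, Function.comp_apply]
  · filter_upwards [hσk] with ε ⟨hε, hfε⟩
    rw [dif_pos hε, hfε]

theorem SmoothOnSubset.exists_smoothCurve {f : A → Y}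
    (hf : SmoothOnSubset 𝓘(𝕜, E) 𝓘(𝕜, E') A f) {k : 𝕜 → X} (hk : SmoothCurve (E := E) 𝕜 k)
    (hkA : ∀ᶠ ε in 𝓝 0, k ε ∈ A) :
    ∃ c : 𝕜 → Y, SmoothCurve (E := E') 𝕜 c ∧ ∀ᶠ ε in 𝓝 0, ∃ h : k ε ∈ A, c ε = f ⟨k ε, h⟩ := by
  obtain ⟨g, hg, hgf⟩ := hf ⟨k 0, hkA.self_of_nhds⟩
  rw [nhds_subtype_eq_comap, Filter.eventually_comap] at hgf
  refine ⟨g ∘ k, ContMDiffAt.comp 0 hg hk, ?_⟩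
  filter_upwards [hkA, (ContMDiffAt.continuousAt hk).eventually hgf] with ε hε hgε
  exact ⟨hε, hgε ⟨k ε, hε⟩ rfl⟩

theorem IsDiffeoBetween.exists_mfderiv_eq (h : IsDiffeoBetween (E := E) (E' := E') 𝕜 f A B)
    (hf : MDifferentiableAt 𝓘(𝕜, E) 𝓘(𝕜, E') f x) (hx : x ∈ A)
    {w : TangentSpace 𝓘(𝕜, E') (f x)} (hw : w ∈ tangentVectors 𝕜 B (f x)) :
    ∃ v ∈ tangentVectors (E := E) 𝕜 A x, mfderiv 𝓘(𝕜, E) 𝓘(𝕜, E') f x v = w := by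
  obtain ⟨k, hk, hkB, hkw⟩ := hw
  obtain ⟨hfAB, -, g, hg, hgs⟩ := h
  obtain ⟨c, hc, hck⟩ := hgs.exists_smoothCurve hk hkB
  have hc₀ : c 0 = x := by
    obtain ⟨hk₀, hc₀⟩ := hck.self_of_nhds
    rw [hc₀]
    exact hfAB.injOn (hg _).1 hx ((hg _).2.trans hkw.base)
  obtain ⟨v, hv⟩ := exists_hasVelocity (E := E) hc₀
  refine ⟨v, ⟨c, hc, ?_, hv⟩, hv.mfderiv_eq hc hf hkw ?_⟩
  · filter_upwards [hck] with ε ⟨hε, hcε⟩ using hcε ▸ (hg _).1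
  · filter_upwards [hck] with ε ⟨hε, hcε⟩ using hcε ▸ (hg _).2

end LocalSections

/-- Transversality of the pair `(a, b) : X → Y₁ × Y₂` to the submanifold `Y₁ × B` at `x`: the
derivative of `a` at `x` and that of `b` modulo the tangent space of `B` are jointly onto. -/
def IsJointlyTransverseAt (𝕜 : Type*) [RCLike 𝕜] {E E₁ E₂ X Y₁ Y₂ : Type*}
    [NormedAddCommGroup E] [NormedSpace 𝕜 E] [TopologicalSpace X] [ChartedSpace E X]
    [NormedAddCommGroup E₁] [NormedSpace 𝕜 E₁] [TopologicalSpace Y₁] [ChartedSpace E₁ Y₁]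
    [NormedAddCommGroup E₂] [NormedSpace 𝕜 E₂] [TopologicalSpace Y₂] [ChartedSpace E₂ Y₂]
    (a : X → Y₁) (b : X → Y₂) (B : Set Y₂) (x : X) : Prop :=
  ∀ (v : TangentSpace 𝓘(𝕜, E₁) (a x)) (w : TangentSpace 𝓘(𝕜, E₂) (b x)),
    ∃ u : TangentSpace 𝓘(𝕜, E) x, mfderiv 𝓘(𝕜, E) 𝓘(𝕜, E₁) a x u = v ∧
      w - mfderiv 𝓘(𝕜, E) 𝓘(𝕜, E₂) b x u ∈ tangentVectors 𝕜 B (b x)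

namespace IsJointlyTransverseAt

variable {𝕜 : Type*} [RCLike 𝕜] {E E₁ E₂ X Y₁ Y₂ : Type*}
  [NormedAddCommGroup E] [NormedSpace 𝕜 E] [TopologicalSpace X] [ChartedSpace E X]
  [NormedAddCommGroup E₁] [NormedSpace 𝕜 E₁] [TopologicalSpace Y₁] [ChartedSpace E₁ Y₁]
  [NormedAddCommGroup E₂] [NormedSpace 𝕜 E₂] [TopologicalSpace Y₂] [ChartedSpace E₂ Y₂]
  [FiniteDimensional 𝕜 E₂]
  {a : X → Y₁} {b : X → Y₂} {B : Set Y₂} {x : X} {U : Set X}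
  {e₁ : OpenPartialHomeomorph Y₁ E₁} {e₂ : OpenPartialHomeomorph Y₂ E₂} {F : Submodule 𝕜 E₂}

theorem surjective_mfderiv_prodMk {C : Type*} [NormedAddCommGroup C] [NormedSpace 𝕜 C]
    (h : IsJointlyTransverseAt (E := E) (E₁ := E₁) (E₂ := E₂) 𝕜 a b B x)
    (ha : MDifferentiableAt 𝓘(𝕜, E) 𝓘(𝕜, E₁) a x) (hb : MDifferentiableAt 𝓘(𝕜, E) 𝓘(𝕜, E₂) b x)
    (he₁ : e₁ ∈ IsManifold.maximalAtlas 𝓘(𝕜, E₁) ∞ Y₁) (hax : a x ∈ e₁.source)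
    (he₂ : IsSliceChart B (b x) e₂ F) (hbx : b x ∈ B) {p : E₂ →L[𝕜] C}
    (hp : Function.Surjective p) (hpF : ∀ u, p u = 0 ↔ u ∈ F) :
    Function.Surjective
      (mfderiv 𝓘(𝕜, E) 𝓘(𝕜, E₁ × C) (fun y => (e₁ (a y), p (e₂ (b y)))) x) := by
  have he₁' := mdifferentiable_of_mem_maximalAtlas he₁
  have he₂' := mdifferentiable_of_mem_maximalAtlas he₂.mem_maximalAtlas
  have hf₁ := (he₁'.mdifferentiableAt hax).hasMFDerivAt.comp x ha.hasMFDerivAt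
  have hf₂ := p.hasMFDerivAt.comp x
    ((he₂'.mdifferentiableAt he₂.mem_source).hasMFDerivAt.comp x hb.hasMFDerivAt)
  have hf : HasMFDerivAt 𝓘(𝕜, E) 𝓘(𝕜, E₁ × C) (fun y => (e₁ (a y), p (e₂ (b y)))) x _ :=
    ⟨hf₁.1.prodMk hf₂.1, hf₁.2.prodMk hf₂.2⟩
  rintro ⟨v₁, c⟩
  obtain ⟨v, hv⟩ := he₁'.mfderiv_surjective hax v₁
  obtain ⟨w₂, hw₂⟩ := hp c
  obtain ⟨w, hw⟩ := he₂'.mfderiv_surjective he₂.mem_source w₂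
  obtain ⟨u, hu, hwu⟩ := h v w
  have hpw := (hpF _).2 ((he₂.mem_tangentVectors_iff hbx).1 hwu)
  rw [map_sub] at hpw
  refine ⟨u, (DFunLike.congr_fun hf.mfderiv u).trans (Prod.ext ?_ ?_)⟩
  · exact (congrArg _ hu).trans hv
  · exact (sub_eq_zero.1 ((map_sub p _ _).symm.trans hpw)).symm.trans ((congrArg p hw).trans hw₂)

theorem exists_straightening
    (h : IsJointlyTransverseAt (E := E) (E₁ := E₁) (E₂ := E₂) 𝕜 a b B x)
    (hU : IsOpen U) (hx : x ∈ U) (ha : ContMDiffOn 𝓘(𝕜, E) 𝓘(𝕜, E₁) ∞ a U)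
    (hb : ContMDiffOn 𝓘(𝕜, E) 𝓘(𝕜, E₂) ∞ b U)
    (he₁ : e₁ ∈ IsManifold.maximalAtlas 𝓘(𝕜, E₁) ∞ Y₁) (hax : a x ∈ e₁.source)
    (he₂ : IsSliceChart B (b x) e₂ F) (hbx : b x ∈ B) :
    ∃ (C : Submodule 𝕜 E₂) (q : Y₂ → C) (V : Set X),
      Module.finrank 𝕜 C + Module.finrank 𝕜 F = Module.finrank 𝕜 E₂ ∧
      IsOpen V ∧ x ∈ V ∧ V ⊆ U ∧ Set.MapsTo a V e₁.source ∧
      (∀ y ∈ V, b y ∈ B ↔ q (b y) = 0) ∧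
      ContMDiffOn 𝓘(𝕜, E) 𝓘(𝕜, E₁ × C) ∞ (fun y => (e₁ (a y), q (b y))) V ∧
      Function.Surjective (mfderiv 𝓘(𝕜, E) 𝓘(𝕜, E₁ × C) (fun y => (e₁ (a y), q (b y))) x) := by
  obtain ⟨C, p, hp, hpF⟩ := exists_continuousLinearMap_ker_eq F
  have hker : (p : E₂ →ₗ[𝕜] C).ker = F := Submodule.ext hpF
  have hfin := (p : E₂ →ₗ[𝕜] C).finrank_range_add_finrank_ker
  rw [LinearMap.range_eq_top.2 hp, finrank_top, hker] at hfin
  have hVa := ha.continuousOn.isOpen_inter_preimage hU e₁.open_source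
  have hVb := hb.continuousOn.isOpen_inter_preimage hU e₂.open_source
  refine ⟨C, fun z => p (e₂ z), (U ∩ a ⁻¹' e₁.source) ∩ (U ∩ b ⁻¹' e₂.source), hfin,
    hVa.inter hVb, ⟨⟨hx, hax⟩, hx, he₂.mem_source⟩, fun y hy => hy.1.1, fun y hy => hy.1.2,
    fun y hy => ?_, ?_, ?_⟩
  · rw [he₂.mem_iff _ hy.2.2, hpF]
  · refine ContMDiffOn.prodMk_space ?_ (p.contMDiff.comp_contMDiffOn ?_)
    · exact (contMDiffOn_of_mem_maximalAtlas he₁).comp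
        (ha.mono fun y hy => hy.1.1) fun y hy => hy.1.2
    · exact (contMDiffOn_of_mem_maximalAtlas he₂.mem_maximalAtlas).comp
        (hb.mono fun y hy => hy.1.1) fun y hy => hy.2.2
  · exact h.surjective_mfderiv_prodMk
      ((ha.contMDiffAt (hU.mem_nhds hx)).mdifferentiableAt (by simp))
      ((hb.contMDiffAt (hU.mem_nhds hx)).mdifferentiableAt (by simp)) he₁ hax he₂ hbx hp hpF

variable [FiniteDimensional 𝕜 E] [FiniteDimensional 𝕜 E₁] [IsManifold 𝓘(𝕜, E) ∞ X]

theorem exists_local_section [IsManifold 𝓘(𝕜, E₁) ∞ Y₁]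
    (h : IsJointlyTransverseAt (E := E) (E₁ := E₁) (E₂ := E₂) 𝕜 a b B x)
    (hU : IsOpen U) (hx : x ∈ U) (ha : ContMDiffOn 𝓘(𝕜, E) 𝓘(𝕜, E₁) ∞ a U)
    (hb : ContMDiffOn 𝓘(𝕜, E) 𝓘(𝕜, E₂) ∞ b U)
    (hB : IsEmbeddedSubmanifold (E := E₂) 𝕜 B) (hbx : b x ∈ B) :
    ∃ σ : Y₁ → X, ContMDiffAt 𝓘(𝕜, E₁) 𝓘(𝕜, E) ∞ σ (a x) ∧ σ (a x) = x ∧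
      ∀ᶠ y in 𝓝 (a x), a (σ y) = y ∧ b (σ y) ∈ B := by
  obtain ⟨F, hF⟩ := hB.exists_isSliceChart
  obtain ⟨e₂, he₂⟩ := hF _ hbx
  let e₁ := chartAt E₁ (a x)
  have he₁ : e₁ ∈ IsManifold.maximalAtlas 𝓘(𝕜, E₁) ∞ Y₁ := IsManifold.chart_mem_maximalAtlas _
  have hax : a x ∈ e₁.source := mem_chart_source E₁ _
  obtain ⟨C, q, V, -, hV, hxV, -, hVe₁, hVB, hf, hf'⟩ :=
    h.exists_straightening hU hx ha hb he₁ hax he₂ hbx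
  obtain ⟨σ, hσ, hσx, hfσ⟩ :=
    exists_local_section_of_surjective_mfderiv (by simp) hV hxV hf hf'
  simp only [(hVB x hxV).1 hbx] at hσ hσx hfσ
  have hs : ContMDiffAt 𝓘(𝕜, E₁) 𝓘(𝕜, E₁ × C) ∞ (fun y => (e₁ y, (0 : C))) (a x) :=
    (contMDiffAt_of_mem_maximalAtlas he₁ hax).prodMk_space contMDiffAt_const
  have hσs : ContMDiffAt 𝓘(𝕜, E₁) 𝓘(𝕜, E) ∞ (fun y => σ (e₁ y, 0)) (a x) :=
    ContMDiffAt.comp (a x) hσ hs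
  have hσV : σ (e₁ (a x), 0) ∈ V := hσx.symm ▸ hxV
  refine ⟨fun y => σ (e₁ y, 0), hσs, hσx, ?_⟩
  filter_upwards [e₁.open_source.mem_nhds hax, hs.continuousAt.eventually hfσ,
    hσs.continuousAt.eventually (hV.mem_nhds hσV)] with y hy hfy hyV
  obtain ⟨hay, hby⟩ := Prod.mk.inj hfy
  exact ⟨e₁.injOn (hVe₁ hyV) hy hay, (hVB _ hyV).2 hby⟩

theorem exists_isSliceChart {A : Set X} {A₁ : Set Y₁} {F₁ : Submodule 𝕜 E₁}
    (h : IsJointlyTransverseAt (E := E) (E₁ := E₁) (E₂ := E₂) 𝕜 a b B x)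
    (hU : IsOpen U) (hx : x ∈ U) (ha : ContMDiffOn 𝓘(𝕜, E) 𝓘(𝕜, E₁) ∞ a U)
    (hb : ContMDiffOn 𝓘(𝕜, E) 𝓘(𝕜, E₂) ∞ b U) (hA : ∀ y ∈ U, (y ∈ A ↔ a y ∈ A₁ ∧ b y ∈ B))
    (he₁ : IsSliceChart A₁ (a x) e₁ F₁) (he₂ : IsSliceChart B (b x) e₂ F) (hbx : b x ∈ B) :
    ∃ (e : OpenPartialHomeomorph X E) (F' : Submodule 𝕜 E),
      Module.finrank 𝕜 F' + Module.finrank 𝕜 E₁ + Module.finrank 𝕜 E₂ =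
        Module.finrank 𝕜 E + Module.finrank 𝕜 F₁ + Module.finrank 𝕜 F ∧
      IsSliceChart A x e F' := by
  obtain ⟨C, q, V, hC, hV, hxV, hVU, hVe₁, hVB, hf, hf'⟩ :=
    h.exists_straightening hU hx ha hb he₁.mem_maximalAtlas he₁.mem_source he₂ hbx
  obtain ⟨e, F', hF', he⟩ := exists_isSliceChart_of_surjective_mfderiv (A := A) hV hxV hf hf'
    (W := F₁.prod ⊥) fun y hy => by
      rw [hA y (hVU hy), he₁.mem_iff _ (hVe₁ hy), hVB y hy, Submodule.mem_prod, Submodule.mem_bot]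
  have hW : Module.finrank 𝕜 (F₁.prod (⊥ : Submodule 𝕜 C)) = Module.finrank 𝕜 F₁ := by
    rw [← Submodule.map_inl]
    exact (F₁.equivMapOfInjective _ LinearMap.inl_injective).finrank_eq.symm
  rw [hW, Module.finrank_prod] at hF'
  exact ⟨e, F', by omega, he⟩

end IsJointlyTransverseAt

section PulledBackCharts

variable {𝕜 : Type*} [RCLike 𝕜] {E Z W : Type*} [NormedAddCommGroup E] [NormedSpace 𝕜 E]
  [TopologicalSpace Z] [ChartedSpace E Z] [TopologicalSpace W] {Φ : W → Z}

/-- The preferred chart of `Z` at `Φ w`, pulled back to `W` along the open embedding `Φ`. -/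
noncomputable def pullbackChart {E Z W : Type*} [TopologicalSpace E] [TopologicalSpace Z]
    [ChartedSpace E Z] [TopologicalSpace W] {Φ : W → Z} (h : Topology.IsOpenEmbedding Φ) (w : W) :
    OpenPartialHomeomorph W E :=
  haveI : Nonempty W := ⟨w⟩
  (h.toOpenPartialHomeomorph Φ).trans (chartAt E (Φ w))

/-- The manifold structure on `W` pulled back along the open embedding `Φ : W → Z`: the unique
structure making `Φ` a local diffeomorphism. -/
noncomputable abbrev pullbackChartedSpace {E Z W : Type*} [TopologicalSpace E]
    [TopologicalSpace Z] [ChartedSpace E Z] [TopologicalSpace W] {Φ : W → Z}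
    (h : Topology.IsOpenEmbedding Φ) : ChartedSpace E W where
  atlas := Set.range (pullbackChart h)
  chartAt := pullbackChart h
  mem_chart_source w := by simp [pullbackChart]
  chart_mem_atlas w := ⟨w, rfl⟩

theorem isManifold_pullbackChartedSpace [IsManifold 𝓘(𝕜, E) ∞ Z] (h : Topology.IsOpenEmbedding Φ) :
    letI := pullbackChartedSpace (E := E) h
    IsManifold 𝓘(𝕜, E) ∞ W := by
  let := pullbackChartedSpace (E := E) h
  apply isManifold_of_contDiffOn
  rintro _ _ ⟨w, rfl⟩ ⟨w', rfl⟩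
  have : Nonempty W := ⟨w⟩
  let c := chartAt E (Φ w)
  let c' := chartAt E (Φ w')
  have hcc' : ContDiffOn 𝕜 ∞ (c' ∘ c.symm) (c.target ∩ c.symm ⁻¹' c'.source) :=
    contMDiffOn_iff_contDiffOn.1 <| contMDiffOn_chart.comp
      (contMDiffOn_chart_symm.mono Set.inter_subset_left) Set.inter_subset_right
  let e := pullbackChart (E := E) h w
  let e' := pullbackChart (E := E) h w'
  have hsrc (u : E) (hu : u ∈ (e.symm.trans e').source) :
      u ∈ c.target ∧ c.symm u ∈ Set.range Φ ∧ Φ (e.symm u) ∈ c'.source := by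
    simpa [pullbackChart, e, e', c, c', and_assoc] using hu
  have hΦ (u : E) (hu : c.symm u ∈ Set.range Φ) : Φ (e.symm u) = c.symm u :=
    h.toOpenPartialHomeomorph_right_inv Φ hu
  refine (hcc'.mono fun u hu => ?_).congr fun u hu => ?_
  · obtain ⟨huc, huΦ, huc'⟩ := hsrc u hu.1
    exact ⟨huc, by rwa [Set.mem_preimage, ← hΦ u huΦ]⟩
  · exact congrArg c' (hΦ u (hsrc u hu.1).2.1)

theorem contMDiffAt_pullbackChartedSpace_iff {E' N : Type*} [NormedAddCommGroup E']
    [NormedSpace 𝕜 E'] [TopologicalSpace N] [ChartedSpace E' N] (h : Topology.IsOpenEmbedding Φ)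
    {k : N → W} {n : N} :
    letI := pullbackChartedSpace (E := E) h
    ContMDiffAt 𝓘(𝕜, E') 𝓘(𝕜, E) ∞ k n ↔ ContMDiffAt 𝓘(𝕜, E') 𝓘(𝕜, E) ∞ (Φ ∘ k) n := by
  let := pullbackChartedSpace (E := E) h
  rw [contMDiffAt_iff_target, contMDiffAt_iff_target (f := Φ ∘ k), h.isInducing.continuousAt_iff]
  rfl

theorem isLocalDiffeomorph_pullbackChartedSpace (h : Topology.IsOpenEmbedding Φ) :
    letI := pullbackChartedSpace (E := E) h
    IsLocalDiffeomorph 𝓘(𝕜, E) 𝓘(𝕜, E) ∞ Φ := by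
  let := pullbackChartedSpace (E := E) h
  intro w
  have : Nonempty W := ⟨w⟩
  let e := h.toOpenPartialHomeomorph Φ
  have he (z : Z) (hz : z ∈ e.target) : Φ (e.symm z) = z := e.right_inv hz
  refine ⟨⟨e.toPartialEquiv, e.open_source, e.open_target, ?_, ?_⟩, trivial, Set.eqOn_refl _ _⟩
  · exact fun w _ => ((contMDiffAt_pullbackChartedSpace_iff h).1 contMDiffAt_id).contMDiffWithinAt
  · refine fun z hz => ContMDiffAt.contMDiffWithinAt <|
      (contMDiffAt_pullbackChartedSpace_iff h).2 <| contMDiffAt_id.congr_of_eventuallyEq ?_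
    filter_upwards [e.open_target.mem_nhds hz] with z hz using he z hz

end PulledBackCharts

section PulledBackStructures

variable {𝕜 : Type*} [RCLike 𝕜] {E Z W : Type*} [NormedAddCommGroup E] [NormedSpace 𝕜 E]
  [TopologicalSpace Z] [ChartedSpace E Z] [TopologicalSpace W] [ChartedSpace E W] {Φ : W → Z}
  {E' M : Type*} [NormedAddCommGroup E'] [NormedSpace 𝕜 E'] [TopologicalSpace M]
  [ChartedSpace E' M]

theorem SmoothOnSubset.of_comp_isLocalDiffeomorph {H' : Type*} [TopologicalSpace H']
    {I : ModelWithCorners 𝕜 E' H'} {X : Type*} [TopologicalSpace X] [ChartedSpace H' X] {A : Set X}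
    {f : A → W} (hΦ : IsLocalDiffeomorph 𝓘(𝕜, E) 𝓘(𝕜, E) ∞ Φ) (hinj : Function.Injective Φ)
    (hf : SmoothOnSubset I 𝓘(𝕜, E) A fun x => Φ (f x)) : SmoothOnSubset I 𝓘(𝕜, E) A f := by
  intro x
  obtain ⟨g, hg, hgf⟩ := hf x
  have hgx : g x = Φ (f x) := hgf.self_of_nhds
  have hx := hΦ (f x)
  refine ⟨hx.localInverse ∘ g, ContMDiffAt.comp _ (hgx ▸ hx.localInverse_contMDiffAt) hg, ?_⟩
  have hmem : ∀ᶠ y : A in 𝓝 x, g y ∈ hx.localInverse.source := by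
    refine (hg.continuousAt.comp continuousAt_subtype_val).eventually_mem
      (hx.localInverse_open_source.mem_nhds ?_)
    exact (congrArg (· ∈ hx.localInverse.source) hgx).mpr hx.localInverse_mem_source
  filter_upwards [hgf, hmem] with y hy hy'
  exact hinj ((hx.localInverse_right_inv hy').trans hy)

theorem isDiffeoBetween_range_of_isLocalDiffeomorph
    (hΦ : IsLocalDiffeomorph 𝓘(𝕜, E) 𝓘(𝕜, E) ∞ Φ) (hinj : Function.Injective Φ) :
    IsDiffeoBetween (E := E) (E' := E) 𝕜 Φ Set.univ (Set.range Φ) := by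
  refine ⟨⟨fun w _ => ⟨w, rfl⟩, hinj.injOn, fun z ⟨w, hw⟩ => ⟨w, trivial, hw⟩⟩,
    .of_contMDiff hΦ.contMDiff, fun z => z.2.choose, fun z => ⟨trivial, z.2.choose_spec⟩,
    .of_comp_isLocalDiffeomorph hΦ hinj ?_⟩
  have hid (z : Set.range Φ) : Φ z.2.choose = z := z.2.choose_spec
  simpa only [hid, id] using SmoothOnSubset.of_contMDiff (A := Set.range Φ) contMDiff_id

theorem IsDiffeoBetween.comp_isLocalDiffeomorph {φ : Z → M} {A : Set Z} {B : Set M}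
    (h : IsDiffeoBetween (E := E) (E' := E') 𝕜 φ A B)
    (hΦ : IsLocalDiffeomorph 𝓘(𝕜, E) 𝓘(𝕜, E) ∞ Φ) (hinj : Function.Injective Φ)
    (hA : A ⊆ Set.range Φ) :
    IsDiffeoBetween (E := E) (E' := E') 𝕜 (φ ∘ Φ) (Φ ⁻¹' A) B := by
  obtain ⟨hbij, hφ, g, hg, hgs⟩ := h
  have hg' (b : B) : ∃ w, Φ w = g b := hA (hg b).1
  choose g' hg' using hg'
  refine ⟨⟨fun w hw => hbij.mapsTo hw, fun w hw w' hw' he => hinj (hbij.injOn hw hw' he),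
    fun b hb => ?_⟩, ?_, g', fun b => ?_, .of_comp_isLocalDiffeomorph hΦ hinj ?_⟩
  · obtain ⟨z, hz, rfl⟩ := hbij.surjOn hb
    obtain ⟨w, rfl⟩ := hA hz
    exact ⟨w, hz, rfl⟩
  · exact hφ.comp (.of_contMDiff hΦ.contMDiff) Subtype.prop
  · simpa only [Set.mem_preimage, Function.comp_apply, hg'] using hg b
  · simpa only [hg'] using hgs

theorem IsResolution.comp_isLocalDiffeomorph {S : Set M} {φ : Z → M}
    (h : IsResolution (EM := E') (EZ := E) 𝕜 S φ)
    (hΦ : IsLocalDiffeomorph 𝓘(𝕜, E) 𝓘(𝕜, E) ∞ Φ) (hinj : Function.Injective Φ)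
    (hS : φ ⁻¹' S ⊆ Set.range Φ) : IsResolution (EM := E') (EZ := E) 𝕜 S (φ ∘ Φ) where
  smooth := h.smooth.comp hΦ.contMDiff
  dense := h.dense.preimage hΦ.isOpenMap
  diffeo := h.diffeo.comp_isLocalDiffeomorph hΦ hinj hS

theorem LieGroupoid.IsRightModule.of_equivariant {EΓ Γ : Type*} [NormedAddCommGroup EΓ]
    [NormedSpace 𝕜 EΓ] [TopologicalSpace Γ] [ChartedSpace EΓ Γ]
    {G : LieGroupoid 𝕜 (EΓ := EΓ) (EM := E') Γ M} {φ : Z → M} {act : Z → Γ → Z}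
    {actW : W → Γ → W} (h : G.IsRightModule (EZ := E) φ act)
    (hΦ : IsLocalDiffeomorph 𝓘(𝕜, E) 𝓘(𝕜, E) ∞ Φ) (hinj : Function.Injective Φ)
    (hact : ∀ w γ, φ (Φ w) = G.src γ → Φ (actW w γ) = act (Φ w) γ) :
    G.IsRightModule (EZ := E) (φ ∘ Φ) actW where
  smooth := h.smooth.comp hΦ.contMDiff
  map_act w γ hw := by
    rw [Function.comp_apply, hact w γ hw, h.map_act _ _ hw]
  act_unit w := hinj <| by
    rw [Function.comp_apply, hact _ _ (G.src_unit _).symm, h.act_unit]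
  act_mul w γ γ' hw hγ := hinj <| by
    rw [hact _ _ (hw.trans (G.src_mul _ _ hγ).symm), h.act_mul _ _ _ hw hγ, hact, hact _ _ hw]
    rw [hact _ _ hw, h.map_act _ _ hw, hγ]
  smooth_act := by
    refine .of_comp_isLocalDiffeomorph hΦ hinj ?_
    simp only [fun p : {p : W × Γ | (φ ∘ Φ) p.1 = G.src p.2} => hact p.1.1 p.1.2 p.2]
    exact SmoothOnSubset.comp h.smooth_act
      (.of_contMDiff (hΦ.contMDiff.prodMap contMDiff_id)) Subtype.prop

end PulledBackStructures

namespace LieGroupoid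

section Basic

variable {𝕜 : Type*} [RCLike 𝕜] {EΓ EM EZ Γ M Z : Type*}
  [NormedAddCommGroup EΓ] [NormedSpace 𝕜 EΓ] [NormedAddCommGroup EM] [NormedSpace 𝕜 EM]
  [NormedAddCommGroup EZ] [NormedSpace 𝕜 EZ]
  [TopologicalSpace Γ] [ChartedSpace EΓ Γ] [TopologicalSpace M] [ChartedSpace EM M]
  [TopologicalSpace Z] [ChartedSpace EZ Z]
  (G : LieGroupoid 𝕜 (EΓ := EΓ) (EM := EM) Γ M) {L : Set M}
  {E N : Type*} [NormedAddCommGroup E] [NormedSpace 𝕜 E] [TopologicalSpace N] [ChartedSpace E N]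

theorem inv_inv (γ : Γ) : G.inv (G.inv γ) = γ := by
  have h : G.mul (G.mul γ (G.inv γ)) (G.inv (G.inv γ)) = G.inv (G.inv γ) := by
    rw [G.mul_inv, ← G.tgt_inv γ, ← G.src_inv (G.inv γ), G.unit_mul]
  rw [← h, G.mul_assoc _ _ _ (G.src_inv γ).symm (G.src_inv _).symm, G.mul_inv, G.src_inv,
    G.mul_unit]

theorem mem_srcIn_iff {γ : Γ} : γ ∈ G.srcIn L ↔ G.src γ ∈ L :=
  Iff.rfl

theorem unit_mem_srcIn {m : M} (hm : m ∈ L) : G.unit m ∈ G.srcIn L := by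
  rwa [mem_srcIn_iff, G.src_unit]

theorem mul_mem_srcIn {γ γ' : Γ} (hγ : γ ∈ G.srcIn L) (h : G.tgt γ = G.src γ') :
    G.mul γ γ' ∈ G.srcIn L := by
  rwa [mem_srcIn_iff, G.src_mul γ γ' h]

theorem contMDiffAt_mul {f g : N → Γ} {n : N} (hf : ContMDiffAt 𝓘(𝕜, E) 𝓘(𝕜, EΓ) ∞ f n)
    (hg : ContMDiffAt 𝓘(𝕜, E) 𝓘(𝕜, EΓ) ∞ g n) (h : ∀ᶠ m in 𝓝 n, G.tgt (f m) = G.src (g m)) :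
    ContMDiffAt 𝓘(𝕜, E) 𝓘(𝕜, EΓ) ∞ (fun m => G.mul (f m) (g m)) n :=
  G.smooth_mul.contMDiffAt_comp (hf.prodMk hg) (h.mono fun _ hm => ⟨hm, rfl⟩)

theorem exists_src_section (γ : Γ) :
    ∃ τ : M → Γ, ContMDiffAt 𝓘(𝕜, EM) 𝓘(𝕜, EΓ) ∞ τ (G.src γ) ∧ τ (G.src γ) = γ ∧
      ∀ᶠ m in 𝓝 (G.src γ), G.src (τ m) = m :=
  exists_local_section_of_isSubmersionAt (G.submersion_src.isSubmersionAt γ)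

theorem surjective_mfderiv_src (γ : Γ) :
    Function.Surjective (mfderiv 𝓘(𝕜, EΓ) 𝓘(𝕜, EM) G.src γ) := by
  obtain ⟨τ, hτ, hτγ, hτs⟩ := G.exists_src_section γ
  exact surjective_mfderiv_of_local_section (G.smooth_src.mdifferentiableAt (by simp))
    (hτ.mdifferentiableAt (by simp)) hτγ hτs

theorem isEmbeddedSubmanifold_srcIn [FiniteDimensional 𝕜 EΓ] [FiniteDimensional 𝕜 EM]
    [IsManifold 𝓘(𝕜, EΓ) ∞ Γ]
    (hL : IsEmbeddedSubmanifold (E := EM) 𝕜 L) : IsEmbeddedSubmanifold (E := EΓ) 𝕜 (G.srcIn L) :=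
  hL.preimage G.smooth_src fun γ _ => G.surjective_mfderiv_src γ

variable {G}

namespace IsRightModule

variable {φ : Z → M} {act : Z → Γ → Z}

theorem contMDiffAt_act (h : G.IsRightModule (EZ := EZ) φ act) {f : N → Z} {g : N → Γ} {n : N}
    (hf : ContMDiffAt 𝓘(𝕜, E) 𝓘(𝕜, EZ) ∞ f n) (hg : ContMDiffAt 𝓘(𝕜, E) 𝓘(𝕜, EΓ) ∞ g n)
    (hfg : ∀ᶠ m in 𝓝 n, φ (f m) = G.src (g m)) :
    ContMDiffAt 𝓘(𝕜, E) 𝓘(𝕜, EZ) ∞ (fun m => act (f m) (g m)) n :=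
  h.smooth_act.contMDiffAt_comp (hf.prodMk hg) (hfg.mono fun _ hm => ⟨hm, rfl⟩)

theorem act_act_inv (h : G.IsRightModule (EZ := EZ) φ act) {z : Z} {γ : Γ} (hz : φ z = G.src γ) :
    act (act z γ) (G.inv γ) = z := by
  rw [← h.act_mul z γ _ hz (G.src_inv γ).symm, G.mul_inv, ← hz, h.act_unit]

theorem exists_contMDiffAt_arrow
    (h : G.IsRightModule (EZ := EZ) φ act) {z : Z} {γ : Γ} (hz : φ z = G.src γ) :
    ∃ τ : Z → Γ, ContMDiffAt 𝓘(𝕜, EZ) 𝓘(𝕜, EΓ) ∞ τ z ∧ τ z = γ ∧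
      ∀ᶠ w in 𝓝 z, φ w = G.src (τ w) := by
  obtain ⟨τ, hτ, hτγ, hτs⟩ := G.exists_src_section γ
  rw [← hz] at hτ hτγ hτs
  refine ⟨τ ∘ φ, hτ.comp z h.smooth.contMDiffAt, hτγ, ?_⟩
  filter_upwards [h.smooth.continuous.continuousAt.eventually hτs] with w hw using hw.symm

theorem mfderiv_mem_baseOrbitTangentVectors (h : G.IsRightModule (EZ := EZ) φ act) {z : Z}
    {v : TangentSpace 𝓘(𝕜, EZ) z} (hv : v ∈ G.orbitTangentVectors φ act z) :
    mfderiv 𝓘(𝕜, EZ) 𝓘(𝕜, EM) φ z v ∈ G.baseOrbitTangentVectors (φ z) := by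
  obtain ⟨c, hc₀, hc, hcs, hcv⟩ := hv
  have hk : SmoothCurve (E := EZ) 𝕜 fun ε => act z (c ε) :=
    h.contMDiffAt_act contMDiffAt_const hc (hcs.mono fun _ hε => hε.symm)
  refine ⟨c, hc₀, hc, hcs, (hcv.comp hk (h.smooth.mdifferentiableAt (by simp))).congr ?_⟩
  filter_upwards [hcs] with ε hε using (h.map_act z _ hε.symm).symm

end IsRightModule

end Basic

/-- `ψ : L → Z` is a smooth lift of the inclusion of the submanifold `L` of `M` to the
`Γ`-module `(Z, φ)`, with image a submanifold `L'` transverse to the `Γ`-orbits. This is the part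
of the data of an `L`-compatible resolution that does not involve the stable submanifold `S`. -/
structure IsTransversalLift {𝕜 : Type*} [RCLike 𝕜] {EΓ EM EZ Γ M Z : Type*}
    [NormedAddCommGroup EΓ] [NormedSpace 𝕜 EΓ] [NormedAddCommGroup EM] [NormedSpace 𝕜 EM]
    [NormedAddCommGroup EZ] [NormedSpace 𝕜 EZ]
    [TopologicalSpace Γ] [ChartedSpace EΓ Γ] [TopologicalSpace M] [ChartedSpace EM M]
    [TopologicalSpace Z] [ChartedSpace EZ Z] (G : LieGroupoid 𝕜 (EΓ := EΓ) (EM := EM) Γ M)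
    (φ : Z → M) (act : Z → Γ → Z) (L : Set M) (L' : Set Z) (ψ : L → Z) : Prop where
  module : G.IsRightModule (EZ := EZ) φ act
  base_submanifold : IsEmbeddedSubmanifold (E := EM) 𝕜 L
  submanifold : IsEmbeddedSubmanifold (E := EZ) 𝕜 L'
  bijOn : Set.BijOn φ L' L
  lift_mem : ∀ m, ψ m ∈ L'
  map_lift : ∀ m, φ (ψ m) = m
  smooth_lift : SmoothOnSubset 𝓘(𝕜, EM) 𝓘(𝕜, EZ) L ψ
  transverse : ∀ z ∈ L',
    tangentVectors (E := EZ) 𝕜 L' z + G.orbitTangentVectors φ act z = Set.univ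

/-- The map `Γ_L → Z`, `γ ↦ ψ (src γ) · γ`, which induces the map of part 2 of the proposition on
the quotient `Z(R) = R \ Γ_L`. -/
def translate {𝕜 : Type*} [RCLike 𝕜] {EΓ EM Γ M Z : Type*}
    [NormedAddCommGroup EΓ] [NormedSpace 𝕜 EΓ] [NormedAddCommGroup EM] [NormedSpace 𝕜 EM]
    [TopologicalSpace Γ] [ChartedSpace EΓ Γ] [TopologicalSpace M] [ChartedSpace EM M]
    (G : LieGroupoid 𝕜 (EΓ := EΓ) (EM := EM) Γ M) (act : Z → Γ → Z) {L : Set M} (ψ : L → Z)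
    (γ : G.srcIn L) : Z :=
  act (ψ ⟨G.src γ, γ.2⟩) γ

namespace IsTransversalLift

variable {𝕜 : Type*} [RCLike 𝕜] {EΓ EM EZ Γ M Z : Type*}
  [NormedAddCommGroup EΓ] [NormedSpace 𝕜 EΓ] [NormedAddCommGroup EM] [NormedSpace 𝕜 EM]
  [NormedAddCommGroup EZ] [NormedSpace 𝕜 EZ]
  [TopologicalSpace Γ] [ChartedSpace EΓ Γ] [TopologicalSpace M] [ChartedSpace EM M]
  [TopologicalSpace Z] [ChartedSpace EZ Z]
  {G : LieGroupoid 𝕜 (EΓ := EΓ) (EM := EM) Γ M} {φ : Z → M} {act : Z → Γ → Z} {L : Set M}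
  {L' : Set Z} {ψ : L → Z}

theorem lift_eq (h : G.IsTransversalLift (EZ := EZ) φ act L L' ψ) {z : Z} (hz : z ∈ L') {m : L}
    (hm : φ z = m) : ψ m = z :=
  h.bijOn.injOn (h.lift_mem m) hz (by rw [h.map_lift, hm])

theorem map_translate (h : G.IsTransversalLift (EZ := EZ) φ act L L' ψ) (γ : G.srcIn L) :
    φ (G.translate act ψ γ) = G.tgt γ :=
  h.module.map_act _ _ (h.map_lift _)

theorem translate_eq (h : G.IsTransversalLift (EZ := EZ) φ act L L' ψ) {z : Z} (hz : z ∈ L') {γ : Γ}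
    (hγ : γ ∈ G.srcIn L) (hzγ : φ z = G.src γ) : G.translate act ψ ⟨γ, hγ⟩ = act z γ :=
  congrArg (act · γ) (h.lift_eq hz hzγ)

theorem translate_unit (h : G.IsTransversalLift (EZ := EZ) φ act L L' ψ) {z : Z} (hz : z ∈ L')
    (hu : G.unit (φ z) ∈ G.srcIn L) : G.translate act ψ ⟨G.unit (φ z), hu⟩ = z := by
  rw [h.translate_eq hz hu (G.src_unit _).symm, h.module.act_unit]

theorem translate_mul (h : G.IsTransversalLift (EZ := EZ) φ act L L' ψ) {γ γ' : Γ}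
    (hγ : γ ∈ G.srcIn L) (hγ' : G.tgt γ = G.src γ') (hm : G.mul γ γ' ∈ G.srcIn L) :
    G.translate act ψ ⟨G.mul γ γ', hm⟩ = act (G.translate act ψ ⟨γ, hγ⟩) γ' := by
  rw [h.translate_eq (h.lift_mem ⟨G.src γ, hγ⟩) hm ((h.map_lift _).trans (G.src_mul γ γ' hγ').symm),
    h.module.act_mul _ γ γ' (h.map_lift _) hγ']
  rfl

theorem range_translate (h : G.IsTransversalLift (EZ := EZ) φ act L L' ψ) :
    Set.range (G.translate act ψ) = orbitOf G φ act L' := by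
  refine Set.Subset.antisymm ?_ ?_
  · rintro _ ⟨γ, rfl⟩
    exact ⟨_, h.lift_mem _, γ, h.map_lift _, rfl⟩
  · rintro _ ⟨z, hz, γ, hzγ, rfl⟩
    exact ⟨⟨γ, (mem_srcIn_iff G).2 (hzγ ▸ h.bijOn.mapsTo hz)⟩, h.translate_eq hz _ hzγ⟩

theorem mem_returnArrows_iff (h : G.IsTransversalLift (EZ := EZ) φ act L L' ψ) {r : Γ} :
    r ∈ G.returnArrows act L L' ψ ↔ ∃ (h₁ : r ∈ G.srcIn L) (h₂ : G.tgt r ∈ L),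
      G.translate act ψ ⟨r, h₁⟩ = ψ ⟨G.tgt r, h₂⟩ := by
  constructor
  · rintro ⟨h₁, h₂⟩
    have h₃ := h.map_translate ⟨r, h₁⟩
    exact ⟨h₁, h₃ ▸ h.bijOn.mapsTo h₂, (h.lift_eq (m := ⟨_, _⟩) h₂ h₃).symm⟩
  · rintro ⟨h₁, h₂, h₃⟩
    exact ⟨h₁, Set.mem_of_eq_of_mem h₃ (h.lift_mem _)⟩

theorem smoothOnSubset_translate (h : G.IsTransversalLift (EZ := EZ) φ act L L' ψ) :
    SmoothOnSubset 𝓘(𝕜, EΓ) 𝓘(𝕜, EZ) (G.srcIn L) (G.translate act ψ) := by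
  have hψ : SmoothOnSubset 𝓘(𝕜, EΓ) 𝓘(𝕜, EZ) (G.srcIn L) fun γ => ψ ⟨G.src γ, γ.2⟩ :=
    h.smooth_lift.comp (.of_contMDiff G.smooth_src) Subtype.prop
  exact h.module.smooth_act.comp (hψ.prodMk (.of_contMDiff contMDiff_id)) fun γ => h.map_lift _

section LocalExtension

variable {A : Γ → Z} {γ : Γ}

theorem exists_mfderiv_eq_of_mem_orbitTangentVectors
    (h : G.IsTransversalLift (EZ := EZ) φ act L L' ψ) (hγ : γ ∈ G.srcIn L)
    (hA : MDifferentiableAt 𝓘(𝕜, EΓ) 𝓘(𝕜, EZ) A γ)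
    (hAt : ∀ᶠ y in 𝓝 γ, ∀ hy : y ∈ G.srcIn L, A y = G.translate act ψ ⟨y, hy⟩)
    {w : TangentSpace 𝓘(𝕜, EZ) (A γ)} (hw : w ∈ G.orbitTangentVectors φ act (A γ)) :
    ∃ u : TangentSpace 𝓘(𝕜, EΓ) γ, mfderiv 𝓘(𝕜, EΓ) 𝓘(𝕜, EM) G.src γ u = 0 ∧
      mfderiv 𝓘(𝕜, EΓ) 𝓘(𝕜, EZ) A γ u = w := by
  obtain ⟨c, hc₀, hc, hcs, hcw⟩ := hw
  have hAγ : A γ = G.translate act ψ ⟨γ, hγ⟩ := hAt.self_of_nhds hγ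
  have hφA : φ (A γ) = G.tgt γ := hAγ ▸ h.map_translate _
  rw [hφA] at hc₀ hcs
  let k : 𝕜 → Γ := fun ε => G.mul γ (c ε)
  have hk₀ : k 0 = γ := by simp only [k, hc₀, G.mul_unit]
  have hk : SmoothCurve (E := EΓ) 𝕜 k :=
    G.contMDiffAt_mul contMDiffAt_const hc (hcs.mono fun _ hε => hε.symm)
  obtain ⟨u, hu⟩ := exists_hasVelocity (E := EΓ) hk₀
  refine ⟨u, ?_, hu.mfderiv_eq hk hA hcw ?_⟩
  · have hconst : HasVelocity (fun _ : 𝕜 => G.src γ) (G.src γ) (0 : TangentSpace 𝓘(𝕜, EM) _) := by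
      have := hasVelocity_mfderiv (E := EM) fun _ : 𝕜 => G.src γ
      rwa [mfderiv_const] at this
    exact hu.mfderiv_eq hk (G.smooth_src.mdifferentiableAt (by simp)) hconst
      (hcs.mono fun ε hε => G.src_mul _ _ hε.symm)
  · have hkγ : Filter.Tendsto k (𝓝 0) (𝓝 γ) := hk₀ ▸ ContMDiffAt.continuousAt hk
    filter_upwards [hcs, hkγ.eventually hAt] with ε hε hAε
    rw [hAε (G.mul_mem_srcIn hγ hε.symm), h.translate_mul hγ hε.symm, hAγ]

theorem exists_mfderiv_eq_of_mem_tangentVectors {m : M}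
    (h : G.IsTransversalLift (EZ := EZ) φ act L L' ψ) (hm : m ∈ L)
    (hA : MDifferentiableAt 𝓘(𝕜, EΓ) 𝓘(𝕜, EZ) A (G.unit m))
    (hAt : ∀ᶠ y in 𝓝 (G.unit m), ∀ hy : y ∈ G.srcIn L, A y = G.translate act ψ ⟨y, hy⟩)
    {w : TangentSpace 𝓘(𝕜, EZ) (A (G.unit m))} (hw : w ∈ tangentVectors 𝕜 L' (A (G.unit m))) :
    ∃ u : TangentSpace 𝓘(𝕜, EΓ) (G.unit m), mfderiv 𝓘(𝕜, EΓ) 𝓘(𝕜, EM) G.src (G.unit m) u ∈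
      tangentVectors 𝕜 L (G.src (G.unit m)) ∧
      mfderiv 𝓘(𝕜, EΓ) 𝓘(𝕜, EZ) A (G.unit m) u = w := by
  obtain ⟨k, hk, hkL', hkw⟩ := hw
  have hφk₀ : φ (k 0) = m := by
    rw [hkw.base, hAt.self_of_nhds (G.unit_mem_srcIn hm), h.map_translate, G.tgt_unit]
  let c : 𝕜 → Γ := fun ε => G.unit (φ (k ε))
  have hc : SmoothCurve (E := EΓ) 𝕜 c :=
    (G.smooth_unit.comp h.module.smooth).contMDiffAt.comp (0 : 𝕜) hk
  have hc₀ : c 0 = G.unit m := congrArg G.unit hφk₀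
  have hcL : ∀ᶠ ε in 𝓝 0, c ε ∈ G.srcIn L :=
    hkL'.mono fun ε hε => G.unit_mem_srcIn (h.bijOn.mapsTo hε)
  obtain ⟨u, hu⟩ := exists_hasVelocity (E := EΓ) hc₀
  refine ⟨u, ?_, hu.mfderiv_eq hc hA hkw ?_⟩
  · exact mfderiv_mem_tangentVectors G.smooth_src.contMDiffAt (.of_forall fun _ => id)
      ⟨c, hc, hcL, hu⟩
  · have hcγ : Filter.Tendsto c (𝓝 0) (𝓝 (G.unit m)) := hc₀ ▸ ContMDiffAt.continuousAt hc
    filter_upwards [hkL', hcL, hcγ.eventually hAt] with ε hε hcε hAε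
    rw [hAε hcε, h.translate_unit hε]

theorem isJointlyTransverseAt_src_translate
    (h : G.IsTransversalLift (EZ := EZ) φ act L L' ψ) (hγ : γ ∈ G.srcIn L)
    (hA : MDifferentiableAt 𝓘(𝕜, EΓ) 𝓘(𝕜, EZ) A γ)
    (hAt : ∀ᶠ y in 𝓝 γ, ∀ hy : y ∈ G.srcIn L, A y = G.translate act ψ ⟨y, hy⟩) (hAγ : A γ ∈ L') :
    IsJointlyTransverseAt (E := EΓ) (E₁ := EM) (E₂ := EZ) 𝕜 G.src A L' γ := by
  intro v w
  obtain ⟨u₁, rfl⟩ := G.surjective_mfderiv_src γ v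
  obtain ⟨l, hl, o, ho, hlo⟩ := Set.mem_add.1 <|
    h.transverse _ hAγ ▸ Set.mem_univ (w - mfderiv 𝓘(𝕜, EΓ) 𝓘(𝕜, EZ) A γ u₁)
  obtain ⟨u₂, hu₂, rfl⟩ := h.exists_mfderiv_eq_of_mem_orbitTangentVectors hγ hA hAt ho
  refine ⟨u₁ + u₂, by rw [map_add, hu₂, add_zero], ?_⟩
  rwa [map_add, ← sub_sub, ← hlo, add_sub_cancel_right]

theorem isJointlyTransverseAt_translate_src_unit {m : M}
    (h : G.IsTransversalLift (EZ := EZ) φ act L L' ψ) (hm : m ∈ L)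
    (hA : MDifferentiableAt 𝓘(𝕜, EΓ) 𝓘(𝕜, EZ) A (G.unit m))
    (hAt : ∀ᶠ y in 𝓝 (G.unit m), ∀ hy : y ∈ G.srcIn L, A y = G.translate act ψ ⟨y, hy⟩)
    (hAm : A (G.unit m) ∈ L') :
    IsJointlyTransverseAt (E := EΓ) (E₁ := EZ) (E₂ := EM) 𝕜 A G.src L (G.unit m) := by
  intro v w
  obtain ⟨u₀, rfl⟩ := G.surjective_mfderiv_src (G.unit m) w
  obtain ⟨l, hl, o, ho, hlo⟩ := Set.mem_add.1 <|
    h.transverse _ hAm ▸ Set.mem_univ (mfderiv 𝓘(𝕜, EΓ) 𝓘(𝕜, EZ) A (G.unit m) u₀ - v)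
  obtain ⟨u₁, hu₁, rfl⟩ := h.exists_mfderiv_eq_of_mem_tangentVectors hm hA hAt hl
  obtain ⟨u₂, hu₂, rfl⟩ :=
    h.exists_mfderiv_eq_of_mem_orbitTangentVectors (G.unit_mem_srcIn hm) hA hAt ho
  refine ⟨u₀ - (u₁ + u₂), ?_, ?_⟩
  · rw [map_sub, map_add, hlo, sub_sub_cancel]
  · rwa [map_sub, map_add, hu₂, add_zero, sub_sub_cancel]

end LocalExtension

end IsTransversalLift

end LieGroupoid

namespace LieGroupoid.IsTransversalLift

variable {𝕜 : Type*} [RCLike 𝕜] {EΓ EM EZ Γ M Z : Type*}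
  [NormedAddCommGroup EΓ] [NormedSpace 𝕜 EΓ] [NormedAddCommGroup EM] [NormedSpace 𝕜 EM]
  [NormedAddCommGroup EZ] [NormedSpace 𝕜 EZ]
  [TopologicalSpace Γ] [ChartedSpace EΓ Γ] [TopologicalSpace M] [ChartedSpace EM M]
  [TopologicalSpace Z] [ChartedSpace EZ Z]
  {G : LieGroupoid 𝕜 (EΓ := EΓ) (EM := EM) Γ M} {φ : Z → M} {act : Z → Γ → Z} {L : Set M}
  {L' : Set Z} {ψ : L → Z}

theorem unit_mem_returnArrows (h : G.IsTransversalLift (EZ := EZ) φ act L L' ψ) {m : M}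
    (hm : m ∈ L) : G.unit m ∈ G.returnArrows act L L' ψ := by
  obtain ⟨z, hz, rfl⟩ := h.bijOn.surjOn hm
  have hu := G.unit_mem_srcIn hm
  exact ⟨hu, Set.mem_of_eq_of_mem (h.translate_unit hz hu) hz⟩

theorem mul_mem_returnArrows (h : G.IsTransversalLift (EZ := EZ) φ act L L' ψ) {r r' : Γ}
    (hr : r ∈ G.returnArrows act L L' ψ) (hr' : r' ∈ G.returnArrows act L L' ψ)
    (hrr' : G.tgt r = G.src r') : G.mul r r' ∈ G.returnArrows act L L' ψ := by
  obtain ⟨hr₁, hr₂, hrψ⟩ := h.mem_returnArrows_iff.1 hr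
  obtain ⟨hr'₁, hr'L'⟩ := hr'
  have hm := G.mul_mem_srcIn hr₁ hrr'
  refine ⟨hm, Set.mem_of_eq_of_mem (h.translate_mul hr₁ hrr' hm) ?_⟩
  rw [hrψ]
  exact Set.mem_of_eq_of_mem (h.translate_eq (h.lift_mem _) hr'₁ ((h.map_lift _).trans hrr')).symm
    hr'L'

theorem inv_mem_returnArrows (h : G.IsTransversalLift (EZ := EZ) φ act L L' ψ) {r : Γ}
    (hr : r ∈ G.returnArrows act L L' ψ) : G.inv r ∈ G.returnArrows act L L' ψ := by
  obtain ⟨hr₁, hrL'⟩ := hr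
  have hφr := h.map_translate ⟨r, hr₁⟩
  have hi : G.inv r ∈ G.srcIn L := by
    rw [G.mem_srcIn_iff, G.src_inv, ← hφr]
    exact h.bijOn.mapsTo hrL'
  refine ⟨hi, Set.mem_of_eq_of_mem ?_ (h.lift_mem ⟨G.src r, hr₁⟩)⟩
  exact (h.translate_eq hrL' hi (hφr.trans (G.src_inv r).symm)).trans
    (h.module.act_act_inv (h.map_lift _))

theorem isClosedSubgroupoid [T2Space Z] (h : G.IsTransversalLift (EZ := EZ) φ act L L' ψ) :
    G.IsClosedSubgroupoid (G.returnArrows act L L' ψ) L := by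
  have htranslate : Continuous fun γ : G.between L L => G.translate act ψ ⟨γ, γ.2.1⟩ :=
    h.smoothOnSubset_translate.continuous.comp (continuous_subtype_val.subtype_mk _)
  have hlift : Continuous fun γ : G.between L L => ψ ⟨G.tgt γ, γ.2.2⟩ :=
    h.smooth_lift.continuous.comp
      ((G.smooth_tgt.continuous.comp continuous_subtype_val).subtype_mk _)
  have hR : {γ : G.between L L | (γ : Γ) ∈ G.returnArrows act L L' ψ} =
      {γ : G.between L L | G.translate act ψ ⟨γ, γ.2.1⟩ = ψ ⟨G.tgt γ, γ.2.2⟩} := by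
    ext γ
    exact h.mem_returnArrows_iff.trans ⟨fun ⟨_, _, hγ⟩ => hγ, fun hγ => ⟨γ.2.1, γ.2.2, hγ⟩⟩
  rw [IsClosedSubgroupoid, hR]
  exact isClosed_eq htranslate hlift

variable [FiniteDimensional 𝕜 EΓ] [FiniteDimensional 𝕜 EM] [IsManifold 𝓘(𝕜, EΓ) ∞ Γ]

theorem exists_extension_isJointlyTransverseAt (h : G.IsTransversalLift (EZ := EZ) φ act L L' ψ)
    {r : Γ} (hr : r ∈ G.returnArrows act L L' ψ) :
    ∃ (A : Γ → Z) (U : Set Γ), IsOpen U ∧ r ∈ U ∧ ContMDiffOn 𝓘(𝕜, EΓ) 𝓘(𝕜, EZ) ∞ A U ∧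
      (∀ γ ∈ U, γ ∈ G.returnArrows act L L' ψ ↔ G.src γ ∈ L ∧ A γ ∈ L') ∧
      IsJointlyTransverseAt (E := EΓ) (E₁ := EM) (E₂ := EZ) 𝕜 G.src A L' r := by
  obtain ⟨hr₁, hrL'⟩ := hr
  obtain ⟨A, U, hU, hrU, hA, hAU⟩ := h.smoothOnSubset_translate.exists_contMDiffOn
    (G.isEmbeddedSubmanifold_srcIn h.base_submanifold) ⟨r, hr₁⟩
  have hAr : A r ∈ L' := Set.mem_of_eq_of_mem (hAU ⟨r, hr₁⟩ hrU) hrL'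
  refine ⟨A, U, hU, hrU, hA, fun γ hγ => ⟨fun ⟨hγL, hγL'⟩ => ⟨hγL, ?_⟩, fun ⟨hγL, hγL'⟩ =>
    ⟨hγL, ?_⟩⟩, h.isJointlyTransverseAt_src_translate hr₁
      ((hA.contMDiffAt (hU.mem_nhds hrU)).mdifferentiableAt (by simp)) ?_ hAr⟩
  · exact Set.mem_of_eq_of_mem (hAU ⟨γ, hγL⟩ hγ) hγL'
  · exact Set.mem_of_eq_of_mem (hAU ⟨γ, hγL⟩ hγ).symm hγL'
  · filter_upwards [hU.mem_nhds hrU] with γ hγ hγL using hAU ⟨γ, hγL⟩ hγ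

variable [FiniteDimensional 𝕜 EZ]

theorem isEmbeddedSubmanifold_returnArrows (h : G.IsTransversalLift (EZ := EZ) φ act L L' ψ) :
    IsEmbeddedSubmanifold (E := EΓ) 𝕜 (G.returnArrows act L L' ψ) := by
  obtain ⟨F, hF⟩ := h.base_submanifold.exists_isSliceChart
  obtain ⟨F', hF'⟩ := h.submanifold.exists_isSliceChart
  refine isEmbeddedSubmanifold_of_finrank (Module.finrank 𝕜 EΓ + Module.finrank 𝕜 F +
    Module.finrank 𝕜 F' - Module.finrank 𝕜 EM - Module.finrank 𝕜 EZ) fun r hr => ?_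
  obtain ⟨A, U, hU, hrU, hA, hAU, htrans⟩ := h.exists_extension_isJointlyTransverseAt hr
  obtain ⟨hrL, hrL'⟩ := (hAU r hrU).1 hr
  obtain ⟨e, he⟩ := hF _ hrL
  obtain ⟨e', he'⟩ := hF' _ hrL'
  obtain ⟨e'', F'', hF'', he''⟩ :=
    htrans.exists_isSliceChart hU hrU G.smooth_src.contMDiffOn hA hAU he he' hrL'
  exact ⟨e'', F'', by omega, he''⟩

theorem exists_src_section_mem_returnArrows [IsManifold 𝓘(𝕜, EM) ∞ M]
    (h : G.IsTransversalLift (EZ := EZ) φ act L L' ψ) {r : Γ} (hr : r ∈ G.returnArrows act L L' ψ) :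
    ∃ σ : M → Γ, ContMDiffAt 𝓘(𝕜, EM) 𝓘(𝕜, EΓ) ∞ σ (G.src r) ∧ σ (G.src r) = r ∧
      ∀ᶠ m in 𝓝 (G.src r), m ∈ L → σ m ∈ G.returnArrows act L L' ψ ∧ G.src (σ m) = m := by
  obtain ⟨A, U, hU, hrU, hA, hAU, htrans⟩ := h.exists_extension_isJointlyTransverseAt hr
  obtain ⟨σ, hσ, hσr, hσA⟩ := htrans.exists_local_section hU hrU G.smooth_src.contMDiffOn hA
    h.submanifold ((hAU r hrU).1 hr).2
  refine ⟨σ, hσ, hσr, ?_⟩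
  have hσU : ∀ᶠ m in 𝓝 (G.src r), σ m ∈ U :=
    hσ.continuousAt.eventually_mem (hU.mem_nhds (hσr.symm ▸ hrU))
  filter_upwards [hσA, hσU] with m ⟨hm, hmL'⟩ hmU hmL
  exact ⟨(hAU _ hmU).2 ⟨hm.symm ▸ hmL, hmL'⟩, hm⟩

theorem isLieSubgroupoid [IsManifold 𝓘(𝕜, EM) ∞ M]
    (h : G.IsTransversalLift (EZ := EZ) φ act L L' ψ) :
    G.IsLieSubgroupoid (G.returnArrows act L L' ψ) L where
  submanifold_arrows := h.isEmbeddedSubmanifold_returnArrows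
  submanifold_units := h.base_submanifold
  src_mem _ hr := hr.choose
  tgt_mem _ hr := (h.mem_returnArrows_iff.1 hr).choose_spec.choose
  unit_mem _ hm := h.unit_mem_returnArrows hm
  inv_mem _ hr := h.inv_mem_returnArrows hr
  mul_mem _ hr _ hr' := h.mul_mem_returnArrows hr hr'
  submersion_src := isSubmersionBetween_of_local_section fun r => by
    obtain ⟨σ, hσ, hσr, hσs⟩ := h.exists_src_section_mem_returnArrows r.2
    exact ⟨σ, hσ, hσr, hσs.mono fun m hm hmL => ⟨(hm hmL).1, (hm hmL).2⟩⟩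
  submersion_tgt := isSubmersionBetween_of_local_section fun r => by
    obtain ⟨σ, hσ, hσr, hσs⟩ :=
      h.exists_src_section_mem_returnArrows (h.inv_mem_returnArrows r.2)
    rw [G.src_inv] at hσ hσr hσs
    refine ⟨G.inv ∘ σ, G.smooth_inv.contMDiffAt.comp _ hσ, ?_, hσs.mono fun m hm hmL => ?_⟩
    · rw [Function.comp_apply, hσr, G.inv_inv]
    · exact ⟨h.inv_mem_returnArrows (hm hmL).1, (G.tgt_inv _).trans (hm hmL).2⟩

variable [IsManifold 𝓘(𝕜, EZ) ∞ Z]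

theorem exists_translate_section_unit (h : G.IsTransversalLift (EZ := EZ) φ act L L' ψ) {z : Z}
    (hz : z ∈ L') :
    ∃ σ : Z → Γ, ContMDiffAt 𝓘(𝕜, EZ) 𝓘(𝕜, EΓ) ∞ σ z ∧ σ z = G.unit (φ z) ∧
      ∀ᶠ w in 𝓝 z, ∃ hw : σ w ∈ G.srcIn L, G.translate act ψ ⟨σ w, hw⟩ = w := by
  have hm := h.bijOn.mapsTo hz
  have hu := G.unit_mem_srcIn hm
  obtain ⟨A, U, hU, huU, hA, hAU⟩ := h.smoothOnSubset_translate.exists_contMDiffOn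
    (G.isEmbeddedSubmanifold_srcIn h.base_submanifold) ⟨G.unit (φ z), hu⟩
  have hAz : A (G.unit (φ z)) = z := (hAU ⟨_, hu⟩ huU).trans (h.translate_unit hz hu)
  have htrans := h.isJointlyTransverseAt_translate_src_unit hm
    ((hA.contMDiffAt (hU.mem_nhds huU)).mdifferentiableAt (by simp))
    (by filter_upwards [hU.mem_nhds huU] with γ hγ hγL using hAU ⟨γ, hγL⟩ hγ) (hAz.symm ▸ hz)
  obtain ⟨σ, hσ, hσu, hσA⟩ := htrans.exists_local_section hU huU hA G.smooth_src.contMDiffOn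
    h.base_submanifold hu
  rw [hAz] at hσ hσu hσA
  refine ⟨σ, hσ, hσu, ?_⟩
  have hσU : ∀ᶠ w in 𝓝 z, σ w ∈ U :=
    hσ.continuousAt.eventually_mem (hU.mem_nhds (hσu.symm ▸ huU))
  filter_upwards [hσA, hσU] with w ⟨hw, hwL⟩ hwU
  exact ⟨hwL, (hAU ⟨σ w, hwL⟩ hwU).symm.trans hw⟩

theorem exists_translate_section (h : G.IsTransversalLift (EZ := EZ) φ act L L' ψ)
    (γ : G.srcIn L) :
    ∃ σ : Z → Γ, ContMDiffAt 𝓘(𝕜, EZ) 𝓘(𝕜, EΓ) ∞ σ (G.translate act ψ γ) ∧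
      σ (G.translate act ψ γ) = γ ∧
      ∀ᶠ z in 𝓝 (G.translate act ψ γ), ∃ hz : σ z ∈ G.srcIn L,
        G.translate act ψ ⟨σ z, hz⟩ = z := by
  -- Move a neighbourhood of `ψ (src γ) · γ` to one of `ψ (src γ)` along `γ⁻¹`, and back.
  have hz₀ := h.map_translate γ
  have hz₁ : act (G.translate act ψ γ) (G.inv γ) = ψ ⟨G.src γ, γ.2⟩ :=
    h.module.act_act_inv (h.map_lift _)
  generalize G.translate act ψ γ = z₀ at hz₀ hz₁ ⊢
  obtain ⟨τ, hτ, hτ₀, hφτ⟩ := h.module.exists_contMDiffAt_arrow (hz₀.trans (G.src_inv _).symm)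
  rw [← hτ₀] at hz₁
  obtain ⟨σ, hσ, hσ₁, hσt⟩ := h.exists_translate_section_unit (h.lift_mem ⟨G.src γ, γ.2⟩)
  rw [← hz₁] at hσ hσt
  have hκ : ContMDiffAt 𝓘(𝕜, EZ) 𝓘(𝕜, EZ) ∞ (fun z => act z (τ z)) z₀ :=
    h.module.contMDiffAt_act contMDiffAt_id hτ hφτ
  have hσκ : ∀ᶠ z in 𝓝 z₀, ∃ hz : σ (act z (τ z)) ∈ G.srcIn L,
      G.translate act ψ ⟨σ (act z (τ z)), hz⟩ = act z (τ z) := hκ.continuousAt.eventually hσt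
  have hcomp : ∀ᶠ z in 𝓝 z₀, G.tgt (σ (act z (τ z))) = G.src (G.inv (τ z)) := by
    filter_upwards [hφτ, hσκ] with z hz ⟨hzL, hzt⟩
    rw [G.src_inv, ← h.module.map_act z _ hz, ← h.map_translate ⟨_, hzL⟩, hzt]
  refine ⟨fun z => G.mul (σ (act z (τ z))) (G.inv (τ z)), G.contMDiffAt_mul
    (ContMDiffAt.comp z₀ hσ hκ) (G.smooth_inv.contMDiffAt.comp z₀ hτ) hcomp, ?_, ?_⟩
  · beta_reduce
    rw [hz₁, hσ₁, hτ₀, G.inv_inv, h.map_lift, G.unit_mul]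
  · filter_upwards [hφτ, hσκ, hcomp] with z hz ⟨hzL, hzt⟩ hzc
    have hzm := G.mul_mem_srcIn hzL hzc
    exact ⟨hzm, by rw [h.translate_mul hzL hzc hzm, hzt, h.module.act_act_inv hz]⟩

theorem isOpenMap_translate (h : G.IsTransversalLift (EZ := EZ) φ act L L' ψ) :
    IsOpenMap (G.translate act ψ) := by
  refine isOpenMap_iff_nhds_le.2 fun γ s hs => ?_
  rw [Filter.mem_map, nhds_subtype_eq_comap] at hs
  obtain ⟨O, hO, hOs⟩ := hs
  obtain ⟨σ, hσ, hσγ, hσt⟩ := h.exists_translate_section γ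
  have hσO : ∀ᶠ z in 𝓝 (G.translate act ψ γ), σ z ∈ O :=
    hσ.continuousAt.eventually_mem (hσγ.symm ▸ hO)
  filter_upwards [hσt, hσO] with z ⟨hz, hzt⟩ hzO
  exact Set.mem_of_eq_of_mem hzt.symm (hOs (a := ⟨σ z, hz⟩) hzO)

end LieGroupoid.IsTransversalLift

namespace LieGroupoid

variable {𝕜 : Type*} [RCLike 𝕜] {EΓ EM EZ Γ M Z : Type*}
  [NormedAddCommGroup EΓ] [NormedSpace 𝕜 EΓ] [NormedAddCommGroup EM] [NormedSpace 𝕜 EM]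
  [NormedAddCommGroup EZ] [NormedSpace 𝕜 EZ]
  [TopologicalSpace Γ] [ChartedSpace EΓ Γ] [TopologicalSpace M] [ChartedSpace EM M]
  [TopologicalSpace Z] [ChartedSpace EZ Z]
  {G : LieGroupoid 𝕜 (EΓ := EΓ) (EM := EM) Γ M} {φ : Z → M} {act : Z → Γ → Z} {L : Set M}
  {L' : Set Z} {ψ : L → Z}

open Classical in
/-- The right action `[γ] · γ' = [γ γ']` of `Γ` on `Z(R) = R \ Γ_L`, with the junk value `[γ]` when
`γ γ'` is not defined. -/
noncomputable def leftQuotientAct (G : LieGroupoid 𝕜 (EΓ := EΓ) (EM := EM) Γ M) (R : Set Γ)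
    (L : Set M) (w : G.LeftQuotient R L) (γ' : Γ) : G.LeftQuotient R L :=
  Quot.lift (fun γ : G.srcIn L => if h : G.tgt γ = G.src γ' then
    G.toLeftQuotient R L ⟨G.mul γ γ', G.mul_mem_srcIn γ.2 h⟩ else G.toLeftQuotient R L γ) (by
      rintro ⟨_, hγ₁⟩ γ ⟨r, hr, hrγ, rfl⟩
      have htgt : G.tgt (G.mul r γ) = G.tgt γ := G.tgt_mul r γ hrγ
      by_cases h : G.tgt γ = G.src γ'
      · rw [dif_pos h, dif_pos (htgt.trans h)]
        exact Quot.sound ⟨r, hr, hrγ.trans (G.src_mul _ _ h).symm, G.mul_assoc r γ γ' hrγ h⟩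
      · rw [dif_neg h, dif_neg (htgt ▸ h)]
        exact Quot.sound ⟨r, hr, hrγ, rfl⟩) w

theorem leftQuotientAct_toLeftQuotient {R : Set Γ} (γ : G.srcIn L) {γ' : Γ}
    (h : G.tgt γ = G.src γ') :
    G.leftQuotientAct R L (G.toLeftQuotient R L γ) γ' =
      G.toLeftQuotient R L ⟨G.mul γ γ', G.mul_mem_srcIn γ.2 h⟩ :=
  dif_pos h

namespace IsTransversalLift

/-- The map `[γ] ↦ ψ (src γ) · γ` from `Z(R)` to `Z`, for `R` the groupoid of return arrows. -/
def quotientMap (h : G.IsTransversalLift (EZ := EZ) φ act L L' ψ) :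
    G.LeftQuotient (G.returnArrows act L L' ψ) L → Z :=
  Quot.lift (G.translate act ψ) (by
    rintro ⟨_, hγ'⟩ γ ⟨r, hr, hrγ, rfl⟩
    obtain ⟨hrs, hrt, hrψ⟩ := h.mem_returnArrows_iff.1 hr
    rw [h.translate_mul hrs hrγ, hrψ]
    exact (h.translate_eq (h.lift_mem _) γ.2 ((h.map_lift _).trans hrγ)).symm)

theorem comp_quotientMap (h : G.IsTransversalLift (EZ := EZ) φ act L L' ψ) :
    φ ∘ h.quotientMap = G.leftQuotientMap (G.returnArrows act L L' ψ) L := by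
  funext w
  induction w using Quot.ind with
  | mk γ => exact h.map_translate γ

theorem quotientMap_leftQuotientAct (h : G.IsTransversalLift (EZ := EZ) φ act L L' ψ)
    (w : G.LeftQuotient (G.returnArrows act L L' ψ) L) (γ' : Γ)
    (hw : φ (h.quotientMap w) = G.src γ') :
    h.quotientMap (G.leftQuotientAct _ L w γ') = act (h.quotientMap w) γ' := by
  induction w using Quot.ind with
  | mk γ =>
    have hγ : G.tgt γ = G.src γ' := (h.map_translate γ).symm.trans hw
    exact (congrArg h.quotientMap (leftQuotientAct_toLeftQuotient γ hγ)).trans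
      (h.translate_mul γ.2 hγ _)

theorem range_quotientMap (h : G.IsTransversalLift (EZ := EZ) φ act L L' ψ) :
    Set.range h.quotientMap = G.orbitOf φ act L' :=
  (Set.range_quot_lift _).trans h.range_translate

theorem quotientMap_injective (h : G.IsTransversalLift (EZ := EZ) φ act L L' ψ) :
    Function.Injective h.quotientMap := by
  rintro ⟨γ⟩ ⟨γ'⟩ (hγγ' : G.translate act ψ γ = G.translate act ψ γ')
  have ht : G.tgt (γ : Γ) = G.tgt (γ' : Γ) := by
    rw [← h.map_translate γ, hγγ', h.map_translate]
  have hc : G.tgt (γ : Γ) = G.src (G.inv (γ' : Γ)) := ht.trans (G.src_inv _).symm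
  have hm : G.mul γ (G.inv γ') ∈ G.srcIn L := G.mul_mem_srcIn γ.2 hc
  have hback : G.translate act ψ ⟨G.mul γ (G.inv γ'), hm⟩ = ψ ⟨G.src γ', γ'.2⟩ := by
    rw [h.translate_mul γ.2 hc, hγγ']
    exact h.module.act_act_inv (h.map_lift _)
  refine Quot.sound ⟨G.mul γ (G.inv γ'), ⟨hm, Set.mem_of_eq_of_mem hback (h.lift_mem _)⟩, ?_, ?_⟩
  · rw [G.tgt_mul _ _ hc, G.tgt_inv]
  · rw [G.mul_assoc _ _ _ hc (G.tgt_inv _), G.inv_mul, ← ht, G.mul_unit]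

variable [FiniteDimensional 𝕜 EΓ] [FiniteDimensional 𝕜 EM] [FiniteDimensional 𝕜 EZ]
  [IsManifold 𝓘(𝕜, EΓ) ∞ Γ] [IsManifold 𝓘(𝕜, EZ) ∞ Z]

theorem isOpenEmbedding_quotientMap (h : G.IsTransversalLift (EZ := EZ) φ act L L' ψ) :
    Topology.IsOpenEmbedding h.quotientMap :=
  .of_continuous_injective_isOpenMap (continuous_quot_lift _ h.smoothOnSubset_translate.continuous)
    h.quotientMap_injective <|
      .of_comp continuous_quot_mk Quot.mk_surjective h.isOpenMap_translate

theorem isQuotientModule [T2Space Z] (h : G.IsTransversalLift (EZ := EZ) φ act L L' ψ) :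
    letI := pullbackChartedSpace (E := EZ) h.isOpenEmbedding_quotientMap
    G.IsQuotientModule (EZ := EZ) (G.returnArrows act L L' ψ) L (G.leftQuotientAct _ L) := by
  have hΦ := h.isOpenEmbedding_quotientMap
  let := pullbackChartedSpace (E := EZ) hΦ
  have hΦs := isLocalDiffeomorph_pullbackChartedSpace (𝕜 := 𝕜) (E := EZ) hΦ
  refine ⟨isManifold_pullbackChartedSpace hΦ, .of_injective_continuous hΦ.injective hΦ.continuous,
    .of_comp_isLocalDiffeomorph hΦs hΦ.injective h.smoothOnSubset_translate,
    isSubmersionBetween_of_local_section fun γ => ?_,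
    fun γ γ' hγ => leftQuotientAct_toLeftQuotient γ hγ⟩
  obtain ⟨σ, hσ, hσγ, hσt⟩ := h.exists_translate_section γ
  refine ⟨σ ∘ h.quotientMap, ContMDiffAt.comp (G.toLeftQuotient _ L γ) hσ hΦs.contMDiff.contMDiffAt,
    hσγ, ?_⟩
  filter_upwards [hΦ.continuous.continuousAt.eventually hσt] with w ⟨hw, hwσ⟩ _
  exact ⟨hw, hΦ.injective hwσ⟩

theorem isModuleIsoOnto_quotientMap (h : G.IsTransversalLift (EZ := EZ) φ act L L' ψ) :
    letI := pullbackChartedSpace (E := EZ) h.isOpenEmbedding_quotientMap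
    G.IsModuleIsoOnto (EZ := EZ) (G.leftQuotientMap (G.returnArrows act L L' ψ) L)
      (G.leftQuotientAct _ L) φ act h.quotientMap (G.orbitOf φ act L') := by
  have hΦ := h.isOpenEmbedding_quotientMap
  let := pullbackChartedSpace (E := EZ) hΦ
  rw [← h.range_quotientMap, ← h.comp_quotientMap]
  exact ⟨hΦ.isOpen_range, isDiffeoBetween_range_of_isLocalDiffeomorph
    (isLocalDiffeomorph_pullbackChartedSpace hΦ) hΦ.injective, fun _ => rfl,
    h.quotientMap_leftQuotientAct⟩

theorem isEquivariantResolution_quotient (h : G.IsTransversalLift (EZ := EZ) φ act L L' ψ)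
    {S : Set M} (hZ : IsResolution (EM := EM) (EZ := EZ) 𝕜 S φ)
    (hS : φ ⁻¹' S ⊆ G.orbitOf φ act L') :
    letI := pullbackChartedSpace (E := EZ) h.isOpenEmbedding_quotientMap
    G.IsEquivariantResolution (EZ := EZ) S (G.leftQuotientMap (G.returnArrows act L L' ψ) L)
      (G.leftQuotientAct _ L) := by
  have hΦ := h.isOpenEmbedding_quotientMap
  let := pullbackChartedSpace (E := EZ) hΦ
  have hΦs := isLocalDiffeomorph_pullbackChartedSpace (𝕜 := 𝕜) (E := EZ) hΦ
  rw [← h.range_quotientMap] at hS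
  rw [← h.comp_quotientMap]
  exact ⟨h.module.of_equivariant hΦs hΦ.injective h.quotientMap_leftQuotientAct,
    hZ.comp_isLocalDiffeomorph hΦs hΦ.injective hS⟩

end IsTransversalLift

end LieGroupoid

section Fullness

variable {𝕜 : Type*} [RCLike 𝕜] {EΓ EM EZ Γ M Z : Type*}
  [NormedAddCommGroup EΓ] [NormedSpace 𝕜 EΓ] [NormedAddCommGroup EM] [NormedSpace 𝕜 EM]
  [NormedAddCommGroup EZ] [NormedSpace 𝕜 EZ]
  [TopologicalSpace Γ] [ChartedSpace EΓ Γ] [TopologicalSpace M] [ChartedSpace EM M]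
  [TopologicalSpace Z] [ChartedSpace EZ Z]
  {G : LieGroupoid 𝕜 (EΓ := EΓ) (EM := EM) Γ M} {S L : Set M} {m : M}
  {φ : Z → M} {act : Z → Γ → Z} {L' : Set Z} {ψ : L → Z}

theorem IsEmbeddedSubmanifold.tangentVectors_subset_of_subset_closure [FiniteDimensional 𝕜 EM]
    (hS : IsEmbeddedSubmanifold (E := EM) 𝕜 S) (hLS : L ⊆ closure S) (hm : m ∈ S) :
    tangentVectors (E := EM) 𝕜 L m ⊆ tangentVectors 𝕜 S m := by
  rintro v ⟨l, hl, hlL, hlv⟩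
  have hlm : Filter.Tendsto l (𝓝 0) (𝓝 m) := hlv.base ▸ ContMDiffAt.continuousAt hl
  refine ⟨l, hl, ?_, hlv⟩
  filter_upwards [hlL, hlm.eventually (hS.eventually_mem_of_mem_closure hm)] with ε hεL hε
  exact hε (hLS hεL)

namespace LieGroupoid

theorem IsStable.baseOrbitTangentVectors_subset (hS : G.IsStable S) (hm : m ∈ S) :
    G.baseOrbitTangentVectors m ⊆ tangentVectors 𝕜 S m := by
  rintro v ⟨c, -, hc, hcs, hcv⟩
  refine ⟨fun ε => G.tgt (c ε), G.smooth_tgt.contMDiffAt.comp 0 hc, ?_, hcv⟩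
  filter_upwards [hcs] with ε hε
  exact (hS _).2 (Set.mem_of_eq_of_mem hε hm)

namespace IsTransversalLift

theorem intersectsTransversally [FiniteDimensional 𝕜 EM]
    (h : G.IsTransversalLift (EZ := EZ) φ act L L' ψ)
    (hS : IsEmbeddedSubmanifold (E := EM) 𝕜 S) (hSG : G.IsStable S)
    (hZ : IsResolution (EM := EM) (EZ := EZ) 𝕜 S φ) (hLS : L ⊆ closure S) :
    G.IntersectsTransversally L S := by
  rintro m ⟨hmL, hmS⟩
  refine Set.Subset.antisymm (fun v hv => ?_) ?_
  · obtain ⟨z, hz, rfl⟩ := h.bijOn.surjOn hmL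
    obtain ⟨w, -, rfl⟩ := hZ.diffeo.exists_mfderiv_eq (hZ.smooth.mdifferentiableAt (by simp)) hmS hv
    obtain ⟨l, hl, o, ho, rfl⟩ := Set.mem_add.1 <| h.transverse z hz ▸ Set.mem_univ w
    exact Set.mem_add.2 ⟨_, h.module.mfderiv_mem_baseOrbitTangentVectors ho, _,
      mfderiv_mem_tangentVectors hZ.smooth.contMDiffAt (.of_forall h.bijOn.mapsTo) hl,
      (add_comm _ _).trans (map_add _ l o).symm⟩
  · rintro _ ⟨v, hv, w, hw, rfl⟩
    exact hS.add_mem_tangentVectors hmS (hSG.baseOrbitTangentVectors_subset hmS hv)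
      (hS.tangentVectors_subset_of_subset_closure hLS hmS hw)

theorem between_subset_returnArrows (h : G.IsTransversalLift (EZ := EZ) φ act L L' ψ)
    (hφ : Set.InjOn φ (φ ⁻¹' S)) :
    G.between (L ∩ S) (L ∩ S) ⊆ G.returnArrows act L L' ψ := by
  rintro r ⟨⟨hrL, -⟩, hrL', hrS'⟩
  have hφr := h.map_translate ⟨r, hrL⟩
  have hφψ := h.map_lift ⟨G.tgt r, hrL'⟩
  refine h.mem_returnArrows_iff.2 ⟨hrL, hrL', hφ ?_ ?_ (hφr.trans hφψ.symm)⟩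
  · rwa [Set.mem_preimage, hφr]
  · rwa [Set.mem_preimage, hφψ]

theorem isLieSubgroupoidFullIn [FiniteDimensional 𝕜 EΓ] [FiniteDimensional 𝕜 EM]
    [FiniteDimensional 𝕜 EZ] [IsManifold 𝓘(𝕜, EΓ) ∞ Γ] [IsManifold 𝓘(𝕜, EM) ∞ M]
    (h : G.IsTransversalLift (EZ := EZ) φ act L L' ψ)
    (hS : IsEmbeddedSubmanifold (E := EM) 𝕜 S) (hSG : G.IsStable S)
    (hZ : IsResolution (EM := EM) (EZ := EZ) 𝕜 S φ) (hLS : L ⊆ closure (L ∩ S))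
    (hmeet : ∀ z, φ z ∈ S → ∃ γ, G.src γ = φ z ∧ act z γ ∈ L') :
    G.IsLieSubgroupoidFullIn (G.returnArrows act L L' ψ) L S := by
  have htrans : G.IntersectsTransversally L S :=
    h.intersectsTransversally hS hSG hZ (hLS.trans (closure_mono Set.inter_subset_right))
  refine ⟨⟨h.isLieSubgroupoid, hLS, htrans, fun m hm => ?_⟩,
    Set.inter_eq_right.2 (h.between_subset_returnArrows hZ.diffeo.1.injOn)⟩
  obtain ⟨z, -, rfl⟩ := hZ.diffeo.1.surjOn hm
  obtain ⟨γ, hγ, hγL⟩ := hmeet z hm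
  exact ⟨γ, hγ, Set.mem_of_eq_of_mem (h.module.map_act z γ hγ.symm).symm (h.bijOn.mapsTo hγL)⟩

end IsTransversalLift

theorem IsRightModule.mem_orbitOf_of_act_mem (h : G.IsRightModule (EZ := EZ) φ act) {z : Z} {γ : Γ}
    (hγ : G.src γ = φ z) (hz : act z γ ∈ L') : z ∈ G.orbitOf φ act L' :=
  ⟨act z γ, hz, G.inv γ, (h.map_act z γ hγ.symm).trans (G.src_inv γ).symm,
    (h.act_act_inv hγ.symm).symm⟩

theorem IsCompatible.isTransversalLift (hL' : G.IsCompatible (EZ := EZ) S φ act L L')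
    (hZ : G.IsRightModule (EZ := EZ) φ act) (hL : IsEmbeddedSubmanifold (E := EM) 𝕜 L)
    (hψ : ∀ m : L, ψ m ∈ L' ∧ φ (ψ m) = m) : G.IsTransversalLift (EZ := EZ) φ act L L' ψ where
  module := hZ
  base_submanifold := hL
  submanifold := hL'.submanifold
  bijOn := hL'.diffeo.1
  lift_mem m := (hψ m).1
  map_lift m := (hψ m).2
  smooth_lift := by
    obtain ⟨hφ, -, g, hg, hgs⟩ := hL'.diffeo
    have hψg : ψ = g := funext fun m =>
      hφ.injOn (hψ m).1 (hg m).1 ((hψ m).2.trans (hg m).2.symm)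
    rwa [hψg]
  transverse := hL'.transverse

end LieGroupoid

end Fullness

theorem mainTheorem4 {𝕜 : Type*} [RCLike 𝕜] {EΓ EM EZ Γ M Z : Type*}
    [NormedAddCommGroup EΓ] [NormedSpace 𝕜 EΓ] [FiniteDimensional 𝕜 EΓ]
    [NormedAddCommGroup EM] [NormedSpace 𝕜 EM] [FiniteDimensional 𝕜 EM]
    [NormedAddCommGroup EZ] [NormedSpace 𝕜 EZ] [FiniteDimensional 𝕜 EZ]
    [TopologicalSpace Γ] [ChartedSpace EΓ Γ] [IsManifold 𝓘(𝕜, EΓ) ∞ Γ]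
    [TopologicalSpace M] [ChartedSpace EM M] [IsManifold 𝓘(𝕜, EM) ∞ M]
    [TopologicalSpace Z] [ChartedSpace EZ Z] [IsManifold 𝓘(𝕜, EZ) ∞ Z] [T2Space Z]
    -- the Lie groupoid `Γ ⇉ M`, the `Γ`-stable submanifold `S`, and the `Γ`-resolution `(Z, φ)`
    (G : LieGroupoid 𝕜 (EΓ := EΓ) (EM := EM) Γ M)
    (S : Set M) (hS : IsEmbeddedSubmanifold (E := EM) 𝕜 S) (hSG : G.IsStable S)
    (φ : Z → M) (act : Z → Γ → Z) (hZ : G.IsEquivariantResolution (EZ := EZ) S φ act)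
    -- the submanifold `L`, its lift `L'` to `Z`, and the inverse `ψ` of `φ : L' → L`
    (L : Set M) (hL : IsEmbeddedSubmanifold (E := EM) 𝕜 L) (hLS : L ⊆ closure (L ∩ S))
    (L' : Set Z) (hL' : G.IsCompatible (EZ := EZ) S φ act L L')
    (ψ : L → Z) (hψ : ∀ m : L, ψ m ∈ L' ∧ φ (ψ m) = m)
    (R : Set Γ) (hR : R = G.returnArrows act L L' ψ) :
    G.IsLieSubgroupoidFullIn R L S ∧
    G.IsClosedSubgroupoid R L ∧
    IsOpen (G.orbitOf φ act L') ∧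
    ∃ (_ : ChartedSpace EZ (G.LeftQuotient R L))
      (actR : G.LeftQuotient R L → Γ → G.LeftQuotient R L),
      G.IsQuotientModule (EZ := EZ) R L actR ∧
      G.IsEquivariantResolution (EZ := EZ) S (G.leftQuotientMap R L) actR ∧
      ∃ Φ : G.LeftQuotient R L → Z,
        (∀ γ : G.srcIn L, Φ (G.toLeftQuotient R L γ) = act (ψ ⟨G.src γ, γ.2⟩) γ) ∧
        G.IsModuleIsoOnto (EZ := EZ) (G.leftQuotientMap R L) actR φ act Φ
          (G.orbitOf φ act L') ∧
        ((∀ z : Z, ∃ γ, G.src γ = φ z ∧ act z γ ∈ L') →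
          G.IsModuleIsoOnto (EZ := EZ) (G.leftQuotientMap R L) actR φ act Φ Set.univ) := by
  subst hR
  have h := hL'.isTransversalLift hZ.1 hL hψ
  let charts := pullbackChartedSpace (E := EZ) h.isOpenEmbedding_quotientMap
  have hiso := h.isModuleIsoOnto_quotientMap
  have hSL' : φ ⁻¹' S ⊆ G.orbitOf φ act L' := fun z hz =>
    have ⟨_, hγ, hγL'⟩ := hL'.meets_orbits z hz
    hZ.1.mem_orbitOf_of_act_mem hγ hγL'
  refine ⟨h.isLieSubgroupoidFullIn hS hSG hZ.2 hLS hL'.meets_orbits, h.isClosedSubgroupoid,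
    hiso.isOpen, charts, G.leftQuotientAct _ L, h.isQuotientModule,
    h.isEquivariantResolution_quotient hZ.2 hSL', h.quotientMap, fun _ => rfl, hiso,
    fun hmeet => ?_⟩
  have huniv : G.orbitOf φ act L' = Set.univ := Set.eq_univ_of_forall fun z =>
    have ⟨_, hγ, hγL'⟩ := hmeet z
    hZ.1.mem_orbitOf_of_act_mem hγ hγL'
  exact huniv ▸ hiso
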